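/- Let $n\ge 0$ and let $p=(p_{ij})$, $q=(q_{ij})$ be complex $n\times n$ matrices with $p_{ij}p_{ji}=1$, $p_{ii}=1$, $q_{ij}q_{ji}=1$, $q_{ii}=1$, and let $\lambda\in\mathbb C$, $\lambda\ne-1$, be such that $p_{ij}q_{ij}=\lambda$ for all $i<j$. Let $\mathcal A$ be the unital associative $\mathbb C$-algebra with generators $a_{ij}$ $(1\le i,j\le n)$ and relations $$a_{ik}a_{il}=q_{kl}a_{il}a_{ik},\qquad a_{ik}a_{jk}=p_{ij}a_{jk}a_{ik},$$ $$a_{ik}a_{jl}-\tfrac{q_{kl}}{q_{ij}}a_{jl}a_{ik}=q_{kl}a_{il}a_{jk}-\tfrac1{q_{ij}}a_{jk}a_{il},\qquad a_{ik}a_{jl}-\tfrac{p_{ij}}{p_{kl}}a_{jl}a_{ik}=p_{ij}a_{jk}a_{il}-\tfrac1{p_{kl}}a_{il}a_{jk}$$ for $i<j$ and $k<l$ (the first for every $i$, the second for every $k$). For $\sigma\in S_n$ put $(-q)_\sigma=(-1)^{l(\sigma)}\prod_{i<j,\ \sigma_i>\sigma_j}q_{\sigma_j\sigma_i}$, where $l(\sigma)$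 is the number of inversions of $\sigma$, and let $A=(a_{ij})$ and $$\det\nolimits_q(A)=\sum_{\sigma\in S_n}(-q)_\sigma\,a_{1,\sigma_1}\cdots a_{n,\sigma_n}.$$ Let $\mathrm{GL}_{p,\lambda}(n)=\mathcal A[\det_q(A)^{-1}]$, and let $K$ be its ring of fractions, that is, the ring obtained from the algebra $\mathrm{GL}_{p,\lambda}(n)$ by universally inverting all its nonzero elements. For a square matrix $X$ over $K$ with rows indexed by $I$ and columns by $J$, the quasideterminant $|X|_{ij}$ $(i\in I,\ j\in J)$ is $y_{ji}^{-1}$, where $Y=X^{-1}=(y_{ji})$; it exists when $X$ and $y_{ji}$ are invertible. Write $A^{i_1\cdots i_r,\,j_1\cdots j_r}$ for the matrix obtained from $A$ by deleting the rows $i_1,\dots,i_r$ and the columns $j_1,\dots,j_r$, the remaining rows and columns keeping their labels. Then for all permutations $\sigma,\tau\in S_n$ and all $1\le k\le n$ the quasi-minor $|A^{\sigma_1\cdots\sigma_{k-1},\,\tau_1\cdots\tau_{k-1}}|_{\sigma_k\tau_k}$ over $K$ exists, for $k=n$ it equals $a_{\sigma_n\tau_n}$, and the following hold in $K$: 1.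 $\det_q(A)=|A|_{11}\,|A^{1,1}|_{22}\,|A^{12,12}|_{33}\cdots a_{nn}$, and the factors on the right-hand side commute pairwise. 2. For all $\sigma,\tau\in S_n$, $$\det\nolimits_q(A)=\frac{(-q)_\tau}{(-q)_\sigma}\,|A|_{\sigma_1\tau_1}\,|A^{\sigma_1,\tau_1}|_{\sigma_2\tau_2}\,|A^{\sigma_1\sigma_2,\,\tau_1\tau_2}|_{\sigma_3\tau_3}\cdots a_{\sigma_n\tau_n}.$$ -/

import Mathlib

noncomputable section

namespace MultiparamGL

/-! ### Localization of a noncommutative algebra -/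

section Localization

variable {R : Type} [Ring R] [Algebra ℂ R] (S : Set R)

/-- Generators of the localization: the elements `r` of `R` and a formal inverse of every `s ∈ S`. -/
inductive LocGen : Type
  | elt (r : R) : LocGen
  | inv (s : S) : LocGen

/-- The letter of an element of `R`. -/
def LocGen.eltWord (r : R) : FreeAlgebra ℂ (LocGen S) := FreeAlgebra.ι ℂ (LocGen.elt r)

/-- The letter of the formal inverse of an element of `S`. -/
def LocGen.invWord (s : S) : FreeAlgebra ℂ (LocGen S) := FreeAlgebra.ι ℂ (LocGen.inv s)

/-- Defining relations of the localization: the operations of `R` are kept, and `S` is inverted. -/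
inductive LocRel : FreeAlgebra ℂ (LocGen S) → FreeAlgebra ℂ (LocGen S) → Prop
  | add (x y : R) : LocRel (LocGen.eltWord S (x + y)) (LocGen.eltWord S x + LocGen.eltWord S y)
  | mul (x y : R) : LocRel (LocGen.eltWord S (x * y)) (LocGen.eltWord S x * LocGen.eltWord S y)
  | scalar (c : ℂ) : LocRel (LocGen.eltWord S (algebraMap ℂ R c)) (algebraMap ℂ _ c)
  | mul_inv (s : S) : LocRel (LocGen.eltWord S s * LocGen.invWord S s) 1
  | inv_mul (s : S) : LocRel (LocGen.invWord S s * LocGen.eltWord S s) 1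

/-- The localization `R[S⁻¹]`: the initial algebra under `R` in which the elements of `S` are
invertible. It is the Ore localization whenever `S` generates an Ore set of regular elements. -/
def Loc : Type := RingQuot (LocRel S)

instance : Ring (Loc S) := inferInstanceAs (Ring (RingQuot (LocRel S)))

instance : Algebra ℂ (Loc S) := inferInstanceAs (Algebra ℂ (RingQuot (LocRel S)))

/-- The class of a word in `R[S⁻¹]`. -/
def Loc.mk : FreeAlgebra ℂ (LocGen S) →ₐ[ℂ] Loc S := RingQuot.mkAlgHom ℂ (LocRel S)

theorem Loc.mk_rel {x y : FreeAlgebra ℂ (LocGen S)} (h : LocRel S x y) :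
    Loc.mk S x = Loc.mk S y := RingQuot.mkAlgHom_rel ℂ h

/-- The canonical homomorphism `R → R[S⁻¹]`. -/
def Loc.of : R →ₐ[ℂ] Loc S :=
  AlgHom.ofLinearMap
    { toFun := fun r => Loc.mk S (LocGen.eltWord S r)
      map_add' := fun x y => by rw [Loc.mk_rel S (LocRel.add x y), map_add]
      map_smul' := fun c x => by
        rw [Algebra.smul_def, Loc.mk_rel S (LocRel.mul _ x), map_mul,
          Loc.mk_rel S (LocRel.scalar c), AlgHom.commutes, RingHom.id_apply, Algebra.smul_def] }
    (by
      have h := Loc.mk_rel S (LocRel.scalar 1)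
      rw [map_one, map_one, map_one] at h
      exact h)
    (fun x y => by
      have h := Loc.mk_rel S (LocRel.mul x y)
      rw [map_mul] at h
      exact h)

/-- The elements of `S` become invertible in `R[S⁻¹]`. -/
theorem Loc.isUnit_of (s : S) : IsUnit (Loc.of S (s : R)) := by
  refine ⟨⟨Loc.of S s, Loc.mk S (LocGen.invWord S s), ?_, ?_⟩, rfl⟩
  · have h := Loc.mk_rel S (LocRel.mul_inv s)
    rw [map_mul, map_one] at h
    exact h
  · have h := Loc.mk_rel S (LocRel.inv_mul s)
    rw [map_mul, map_one] at h
    exact h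

end Localization

/-- The ring of fractions of a noncommutative domain: every nonzero element is inverted. For an Ore
domain this is its division ring of fractions. -/
abbrev Fractions (R : Type) [Ring R] [Algebra ℂ R] : Type := Loc {x : R | x ≠ 0}

/-! ### Quantum determinants -/

/-- The set of inversions of `σ`. -/
def inversions {n : ℕ} (σ : Equiv.Perm (Fin n)) : Finset (Fin n × Fin n) :=
  Finset.univ.filter fun x => x.1 < x.2 ∧ σ x.2 < σ x.1

/-- `(-q)_σ = (-1)^{l(σ)} ∏_{i < j, σ_i > σ_j} q_{σ_j σ_i}`. -/
def qInversion {n : ℕ} (q : Matrix (Fin n) (Fin n) ℂ) (σ : Equiv.Perm (Fin n)) : ℂ :=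
  (-1) ^ (inversions σ).card * ∏ x ∈ inversions σ, q (σ x.2) (σ x.1)

/-- `det_q(X) = ∑_σ (-q)_σ x_{1,σ_1} ⋯ x_{n,σ_n}`, with the factors in the order of the rows. -/
def qDet {n : ℕ} {R : Type} [Ring R] [Algebra ℂ R] (q : Matrix (Fin n) (Fin n) ℂ)
    (X : Matrix (Fin n) (Fin n) R) : R :=
  ∑ σ : Equiv.Perm (Fin n), qInversion q σ • (List.ofFn fun i => X i (σ i)).prod

/-! ### The quantum semigroup and the quantum group -/

section QuantumGroup

variable {n : ℕ} (p q : Matrix (Fin n) (Fin n) ℂ)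

/-- The free generator `a_{ij}`. -/
def freeGen (i j : Fin n) : FreeAlgebra ℂ (Fin n × Fin n) := FreeAlgebra.ι ℂ (i, j)

/-- The defining relations of the algebra of quantum matrices. -/
inductive MatRel : FreeAlgebra ℂ (Fin n × Fin n) → FreeAlgebra ℂ (Fin n × Fin n) → Prop
  | row (i k l : Fin n) (hkl : k < l) :
      MatRel (freeGen i k * freeGen i l) (q k l • (freeGen i l * freeGen i k))
  | col (i j k : Fin n) (hij : i < j) :
      MatRel (freeGen i k * freeGen j k) (p i j • (freeGen j k * freeGen i k))
  | crossQ (i j k l : Fin n) (hij : i < j) (hkl : k < l) :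
      MatRel
        (freeGen i k * freeGen j l - (q k l / q i j) • (freeGen j l * freeGen i k))
        (q k l • (freeGen i l * freeGen j k) - (1 / q i j) • (freeGen j k * freeGen i l))
  | crossP (i j k l : Fin n) (hij : i < j) (hkl : k < l) :
      MatRel
        (freeGen i k * freeGen j l - (p i j / p k l) • (freeGen j l * freeGen i k))
        (p i j • (freeGen j k * freeGen i l) - (1 / p k l) • (freeGen i l * freeGen j k))

/-- The algebra `𝒜` of multiparameter quantum matrices. -/
def QMat : Type := RingQuot (MatRel p q)

instance : Ring (QMat p q) := inferInstanceAs (Ring (RingQuot (MatRel p q)))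

instance : Algebra ℂ (QMat p q) := inferInstanceAs (Algebra ℂ (RingQuot (MatRel p q)))

/-- The matrix `(a_{ij})` of generators of `𝒜`. -/
def QMat.gen : Matrix (Fin n) (Fin n) (QMat p q) :=
  fun i j => RingQuot.mkAlgHom ℂ (MatRel p q) (freeGen i j)

/-- The quantum determinant of the matrix of generators of `𝒜`. -/
def QMat.det : QMat p q := qDet q (QMat.gen p q)

/-- The quantum group `GL_{p,λ}(n) = 𝒜[det_q⁻¹]`. -/
abbrev QGL : Type := Loc {QMat.det p q}

/-- The matrix of generators of `GL_{p,λ}(n)`. -/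
def QGL.gen : Matrix (Fin n) (Fin n) (QGL p q) := (QMat.gen p q).map (Loc.of {QMat.det p q})

/-- The ring of fractions of `GL_{p,λ}(n)`. -/
abbrev QFrac : Type := Fractions (QGL p q)

/-- The matrix of generators of `GL_{p,λ}(n)`, over the ring of fractions. -/
def QFrac.gen : Matrix (Fin n) (Fin n) (QFrac p q) :=
  (QGL.gen p q).map (Loc.of {x : QGL p q | x ≠ 0})

end QuantumGroup

/-! ### Quasideterminants -/

section Quasideterminant

variable {K : Type} [Ring K] {I J : Type} [Fintype I] [Fintype J] [DecidableEq I] [DecidableEq J]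

/-- `Y` is the two-sided inverse of the matrix `X`. -/
def IsMatInverse (X : Matrix I J K) (Y : Matrix J I K) : Prop := X * Y = 1 ∧ Y * X = 1

/-- The quasideterminant `|X|_{ij}` exists: `X` has an inverse `Y`, and `y_{ji}` is invertible. -/
def QuasidetExists (X : Matrix I J K) (i : I) (j : J) : Prop :=
  ∃ Y : Matrix J I K, IsMatInverse X Y ∧ IsUnit (Y j i)

open Classical in
/-- The quasideterminant `|X|_{ij} = y_{ji}⁻¹`, where `Y = X⁻¹` (and `0` if it does not exist). -/
def quasidet (X : Matrix I J K) (i : I) (j : J) : K :=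
  if h : ∃ Y : Matrix J I K, IsMatInverse X Y then Ring.inverse (h.choose j i) else 0

end Quasideterminant

section QuasiMinor

variable {K : Type} [Ring K] {n : ℕ}

/-- The indices that remain when `σ_l` is deleted for all `l < k`. -/
abbrev Remaining (σ : Equiv.Perm (Fin n)) (k : Fin n) : Type := {i : Fin n // ∀ l < k, i ≠ σ l}

/-- The index `σ_k`, which remains when `σ_l` is deleted for all `l < k`. -/
def Remaining.head (σ : Equiv.Perm (Fin n)) (k : Fin n) : Remaining σ k :=
  ⟨σ k, fun _ hl h => hl.ne (σ.injective h).symm⟩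

/-- The submatrix of `X` left when the rows `σ_l` and the columns `τ_l` with `l < k` are deleted. -/
def remainingMatrix (X : Matrix (Fin n) (Fin n) K) (σ τ : Equiv.Perm (Fin n)) (k : Fin n) :
    Matrix (Remaining σ k) (Remaining τ k) K :=
  X.submatrix Subtype.val Subtype.val

/-- The quasi-minor `|X^{σ_1 ⋯ σ_{k-1}, τ_1 ⋯ τ_{k-1}}|_{σ_k τ_k}` (indices counted from `1`). -/
def quasiMinor (X : Matrix (Fin n) (Fin n) K) (σ τ : Equiv.Perm (Fin n)) (k : Fin n) : K :=
  quasidet (remainingMatrix X σ τ k) (Remaining.head σ k) (Remaining.head τ k)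

/-- This quasi-minor exists. -/
def QuasiMinorExists (X : Matrix (Fin n) (Fin n) K) (σ τ : Equiv.Perm (Fin n)) (k : Fin n) :
    Prop :=
  QuasidetExists (remainingMatrix X σ τ k) (Remaining.head σ k) (Remaining.head τ k)

end QuasiMinor

end MultiparamGL

end

/-!
A row of a quantum matrix gives a linear form `η_i = ∑_j x_{ij} ξ_j` over the `q`-exterior algebra,
and half of the defining relations says precisely that the `η_i` satisfy the relations of that
algebra: `η_j η_i = -q_{ij} η_i η_j` (`RowRel`). The coefficients of the products of the `η_i` are the
quantum minors (`rowMinor`). They have Laplace expansions along the first and the last row, vanish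
if a row is repeated, and are multiplied by a scalar if the rows are permuted. The other half of the
relations says the same of the columns, with `p` in place of `q`. For `λ ≠ -1` the two halves
together give `q_{kl} x_{il} x_{jk} = p_{ij} x_{jk} x_{il}` for `i < j` and `k < l`, whence minors
computed by rows and by columns agree (`IsQuantumMatrix.rowMinor_sort_transpose`).

If all minors are invertible, the row expansions give a right inverse of each square submatrix and
the column expansions a left inverse. The entries of the inverse are quotients of minors, so each
quasi-minor is a scalar times a quotient of two consecutive minors in a chain (`quasiMinor_eq`). The
product of the quasi-minors telescopes to the quantum determinant, and the scalars collect to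
`(-q)_σ / (-q)_τ` (`prod_quasiMinor`). Comparing the two formulas for the inverse of a principal
submatrix shows that a principal minor commutes with each entry `x_{ij}` of its submatrix up to a
factor `w_j / w_i`, hence with all smaller principal minors (`commute_rowMinor_of_subset`).

The minors become invertible in the ring of fractions once they are nonzero in the quantum group.
This is shown by finite-dimensional representations (`hasNonzeroMinor`). Products of commuting
quantum matrices are quantum matrices, and there are elementary quantum matrices over `2 × 2`
matrices, with a nilpotent entry in a position `(a, b)` for adjacent `a` and `b`. Multiplication by
such a matrix carries the nonvanishing of a minor from one set of rows to another that differs by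
exchanging `a` and `b`; since the minors of the identity matrix with equal rows and columns are `1`,
all pairs of rows and columns are reached.
-/

noncomputable section

namespace MultiparamGL

/-! ### Multiplicatively antisymmetric matrices and reordering signs -/

/-- A multiplicatively antisymmetric matrix: `q_{ij} q_{ji} = 1` and `q_{ii} = 1`. -/
structure IsMulAntisymm {n : ℕ} (q : Matrix (Fin n) (Fin n) ℂ) : Prop where
  mul_swap : ∀ i j, q i j * q j i = 1
  diag : ∀ i, q i i = 1

section Sign

variable {n : ℕ} {q : Matrix (Fin n) (Fin n) ℂ}

theorem IsMulAntisymm.ne_zero (hq : IsMulAntisymm q) (i j : Fin n) : q i j ≠ 0 :=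
  left_ne_zero_of_mul_eq_one (hq.mul_swap i j)

/-- The scalar that sorts `ξ_j ξ_{J \ j}` into `ξ_J` in the `q`-exterior algebra, whose generators
satisfy `ξ_j ξ_k = -q_{kj} ξ_k ξ_j` for `k ≠ j`. -/
def leftSign (q : Matrix (Fin n) (Fin n) ℂ) (j : Fin n) (J : Finset (Fin n)) : ℂ :=
  ∏ k ∈ J with k < j, -q k j

/-- The scalar that sorts `ξ_{J \ j} ξ_j` into `ξ_J` in the `q`-exterior algebra. -/
def rightSign (q : Matrix (Fin n) (Fin n) ℂ) (j : Fin n) (J : Finset (Fin n)) : ℂ :=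
  ∏ k ∈ J with j < k, -q j k

theorem leftSign_ne_zero (hq : IsMulAntisymm q) (j : Fin n) (J : Finset (Fin n)) :
    leftSign q j J ≠ 0 :=
  Finset.prod_ne_zero_iff.2 fun k _ => neg_ne_zero.2 (hq.ne_zero k j)

theorem rightSign_ne_zero (hq : IsMulAntisymm q) (j : Fin n) (J : Finset (Fin n)) :
    rightSign q j J ≠ 0 :=
  Finset.prod_ne_zero_iff.2 fun k _ => neg_ne_zero.2 (hq.ne_zero j k)

theorem leftSign_erase_of_le {j k : Fin n} (h : j ≤ k) (J : Finset (Fin n)) :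
    leftSign q j (J.erase k) = leftSign q j J := by
  refine Finset.prod_congr (Finset.ext fun m => ?_) fun _ _ => rfl
  simp only [Finset.mem_filter, Finset.mem_erase]
  grind

theorem leftSign_eq_of_lt {j k : Fin n} (h : k < j) {J : Finset (Fin n)} (hk : k ∈ J) :
    leftSign q j J = -q k j * leftSign q j (J.erase k) := by
  unfold leftSign
  rw [Finset.filter_erase, Finset.mul_prod_erase _ (fun k => -q k j)
    (Finset.mem_filter.2 ⟨hk, h⟩)]

theorem rightSign_erase_of_le {j k : Fin n} (h : k ≤ j) (J : Finset (Fin n)) :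
    rightSign q j (J.erase k) = rightSign q j J := by
  refine Finset.prod_congr (Finset.ext fun m => ?_) fun _ _ => rfl
  simp only [Finset.mem_filter, Finset.mem_erase]
  grind

theorem rightSign_eq_of_lt {j k : Fin n} (h : j < k) {J : Finset (Fin n)} (hk : k ∈ J) :
    rightSign q j J = -q j k * rightSign q j (J.erase k) := by
  unfold rightSign
  rw [Finset.filter_erase, Finset.mul_prod_erase _ (fun k => -q j k)
    (Finset.mem_filter.2 ⟨hk, h⟩)]

theorem leftSign_eq_one {j : Fin n} {J : Finset (Fin n)} (h : ∀ k ∈ J, j ≤ k) :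
    leftSign q j J = 1 := by
  unfold leftSign
  rw [Finset.filter_false_of_mem fun k hk => not_lt.2 (h k hk), Finset.prod_empty]

theorem leftSign_mul_swap (hq : IsMulAntisymm q) {J : Finset (Fin n)} {k m : Fin n} (hk : k ∈ J)
    (hm : m ∈ J) (hkm : k ≠ m) :
    leftSign q m J * leftSign q k (J.erase m) =
      -q k m * (leftSign q k J * leftSign q m (J.erase k)) := by
  rcases lt_or_gt_of_ne hkm with h | h
  · rw [leftSign_eq_of_lt h hk, leftSign_erase_of_le h.le]
    ring
  · rw [leftSign_eq_of_lt h hm, leftSign_erase_of_le h.le]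
    linear_combination (-leftSign q m J * leftSign q k (J.erase m)) * hq.mul_swap k m

theorem leftSign_mul_rightSign {J : Finset (Fin n)} {k m : Fin n} (hk : k ∈ J)
    (hm : m ∈ J) (hkm : k ≠ m) :
    leftSign q k J * rightSign q m (J.erase k) =
      rightSign q m J * leftSign q k (J.erase m) := by
  rcases lt_or_gt_of_ne hkm with h | h
  · rw [rightSign_erase_of_le h.le, leftSign_erase_of_le h.le, mul_comm]
  · rw [leftSign_eq_of_lt h hm, rightSign_eq_of_lt h hk]
    ring

end Sign

/-! ### Quantum minors -/

section Minor

variable {n : ℕ} {R : Type} [Ring R] [Algebra ℂ R]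

/-- The quantum minor with the rows `l`, in the order of the list, and the set of columns `J`: the
coefficient of `ξ_J` in `∏_{i ∈ l} η_i`, where `η_i = ∑_j x_{ij} ξ_j` and the `ξ_j` are the
generators of the `q`-exterior algebra. It is defined by expansion along the first row. -/
def rowMinor (q : Matrix (Fin n) (Fin n) ℂ) (X : Matrix (Fin n) (Fin n) R) :
    List (Fin n) → Finset (Fin n) → R
  | [], J => if J = ∅ then 1 else 0
  | i :: l, J => ∑ j ∈ J, leftSign q j J • (X i j * rowMinor q X l (J.erase j))

/-- The row half of the relations of quantum matrices, in a form without order conditions. It says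
that the linear forms `η_i = ∑_j x_{ij} ξ_j` satisfy the relations of the `q`-exterior algebra. -/
def RowRel (q : Matrix (Fin n) (Fin n) ℂ) (X : Matrix (Fin n) (Fin n) R) : Prop :=
  ∀ i j k l, X j k * X i l + q i j • (X i k * X j l) =
    q k l • (X j l * X i k + q i j • (X i l * X j k))

variable {p q : Matrix (Fin n) (Fin n) ℂ} {X : Matrix (Fin n) (Fin n) R}

theorem rowMinor_nil (J : Finset (Fin n)) : rowMinor q X [] J = if J = ∅ then 1 else 0 := rfl

theorem rowMinor_cons (i : Fin n) (l : List (Fin n)) (J : Finset (Fin n)) :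
    rowMinor q X (i :: l) J =
      ∑ j ∈ J, leftSign q j J • (X i j * rowMinor q X l (J.erase j)) := rfl

theorem sum_sum_erase_comm {M : Type*} [AddCommMonoid M] (J : Finset (Fin n))
    (f : Fin n → Fin n → M) :
    ∑ k ∈ J, ∑ m ∈ J.erase k, f k m = ∑ m ∈ J, ∑ k ∈ J.erase m, f k m := by
  refine Finset.sum_comm' fun k m => ?_
  simp only [Finset.mem_erase]
  tauto

theorem rowMinor_cons_cons (i j : Fin n) (l : List (Fin n)) (J : Finset (Fin n)) :
    rowMinor q X (i :: j :: l) J = ∑ k ∈ J, ∑ m ∈ J.erase k,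
      (leftSign q k J * leftSign q m (J.erase k)) •
        (X i k * X j m * rowMinor q X l ((J.erase k).erase m)) := by
  simp only [rowMinor_cons, Finset.mul_sum, Finset.smul_sum, mul_smul_comm, smul_smul, mul_assoc]

/-- `η_j η_i = -q_{ij} η_i η_j`, for all `i` and `j`. -/
theorem rowMinor_swap (hq : IsMulAntisymm q) (hX : RowRel q X) (i j : Fin n) (l : List (Fin n))
    (J : Finset (Fin n)) :
    rowMinor q X (j :: i :: l) J + q i j • rowMinor q X (i :: j :: l) J = 0 := by
  -- the sum over ordered pairs of columns changes sign when the two columns are exchanged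
  let f : Fin n → Fin n → R := fun k m => (leftSign q k J * leftSign q m (J.erase k)) •
    ((X j k * X i m + q i j • (X i k * X j m)) * rowMinor q X l ((J.erase k).erase m))
  have h1 : rowMinor q X (j :: i :: l) J + q i j • rowMinor q X (i :: j :: l) J =
      ∑ k ∈ J, ∑ m ∈ J.erase k, f k m := by
    simp only [rowMinor_cons_cons, Finset.smul_sum, ← Finset.sum_add_distrib, f]
    refine Finset.sum_congr rfl fun k _ => Finset.sum_congr rfl fun m _ => ?_
    rw [add_mul, smul_add, smul_mul_assoc, smul_comm (q i j)]
  have h2 : ∑ k ∈ J, ∑ m ∈ J.erase k, f k m = -∑ k ∈ J, ∑ m ∈ J.erase k, f k m := by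
    conv_rhs => rw [sum_sum_erase_comm]
    rw [← Finset.sum_neg_distrib]
    refine Finset.sum_congr rfl fun k hk => ?_
    rw [← Finset.sum_neg_distrib]
    refine Finset.sum_congr rfl fun m hm => ?_
    have hm' := Finset.mem_erase.1 hm
    simp only [f]
    rw [leftSign_mul_swap hq hk hm'.2 hm'.1.symm, hX i j k m, Finset.erase_right_comm,
      smul_mul_assoc, smul_smul, ← neg_smul]
    congr 1
    ring
  rw [h1]
  have h3 : (2 : ℂ) • ∑ k ∈ J, ∑ m ∈ J.erase k, f k m = 0 := by
    rw [two_smul]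
    exact add_eq_zero_iff_eq_neg.2 h2
  exact (smul_eq_zero_iff_right two_ne_zero).1 h3

theorem rowMinor_self_cons (hq : IsMulAntisymm q) (hX : RowRel q X) (i : Fin n) (l : List (Fin n))
    (J : Finset (Fin n)) : rowMinor q X (i :: i :: l) J = 0 := by
  have h := rowMinor_swap hq hX i i l J
  rw [hq.diag, one_smul, ← two_smul ℂ] at h
  exact (smul_eq_zero_iff_right two_ne_zero).1 h

/-- Permuting the rows multiplies a quantum minor by a nonzero scalar that depends on neither the
ring nor the matrix nor the columns; the matrix `1` may thus be used to compute it. -/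
theorem exists_rowMinor_perm (hq : IsMulAntisymm q) {l l' : List (Fin n)} (h : l.Perm l') :
    ∃ c : ℂ, c ≠ 0 ∧ ∀ (R : Type) [Ring R] [Algebra ℂ R] (X : Matrix (Fin n) (Fin n) R),
      RowRel q X → ∀ J, rowMinor q X l J = c • rowMinor q X l' J := by
  induction h with
  | nil => exact ⟨1, one_ne_zero, fun R _ _ X _ J => (one_smul _ _).symm⟩
  | cons x _ ih =>
    obtain ⟨c, hc, h⟩ := ih
    refine ⟨c, hc, fun R _ _ X hX J => ?_⟩
    simp only [rowMinor_cons, h R X hX, Finset.smul_sum, mul_smul_comm, smul_comm c]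
  | swap x y l =>
    refine ⟨-q x y, neg_ne_zero.2 (hq.ne_zero x y), fun R _ _ X hX J => ?_⟩
    rw [neg_smul]
    exact eq_neg_of_add_eq_zero_left (rowMinor_swap hq hX x y l J)
  | trans _ _ ih₁ ih₂ =>
    obtain ⟨c, hc, h⟩ := ih₁
    obtain ⟨d, hd, h'⟩ := ih₂
    refine ⟨c * d, mul_ne_zero hc hd, fun R _ _ X hX J => ?_⟩
    rw [h R X hX, h' R X hX, smul_smul]

theorem rowMinor_cons_of_mem (hq : IsMulAntisymm q) (hX : RowRel q X) {i : Fin n}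
    {l : List (Fin n)} (hi : i ∈ l) (J : Finset (Fin n)) : rowMinor q X (i :: l) J = 0 := by
  obtain ⟨c, -, h⟩ := exists_rowMinor_perm hq ((List.perm_cons_erase hi).cons i)
  rw [h R X hX, rowMinor_self_cons hq hX, smul_zero]

/-- Expansion of a quantum minor along its last row. -/
theorem rowMinor_append_singleton (l : List (Fin n)) (i : Fin n) (J : Finset (Fin n)) :
    rowMinor q X (l ++ [i]) J =
      ∑ j ∈ J, rightSign q j J • (rowMinor q X l (J.erase j) * X i j) := by
  induction l generalizing J with
  | nil =>
    simp only [List.nil_append, rowMinor_cons, rowMinor_nil]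
    refine Finset.sum_congr rfl fun j hj => ?_
    by_cases h : J.erase j = ∅
    · have hJ : J = {j} := by rw [← Finset.insert_erase hj, h]; rfl
      subst hJ
      rw [if_pos h, leftSign_eq_one (by simp), one_mul, mul_one, rightSign,
        Finset.filter_false_of_mem (by simp), Finset.prod_empty]
    · rw [if_neg h, zero_mul, mul_zero, smul_zero, smul_zero]
  | cons a l ih =>
    simp only [List.cons_append, rowMinor_cons, ih, Finset.mul_sum, Finset.sum_mul,
      Finset.smul_sum, mul_smul_comm, smul_mul_assoc, smul_smul]
    rw [sum_sum_erase_comm]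
    refine Finset.sum_congr rfl fun m hm => Finset.sum_congr rfl fun k hk => ?_
    have hk' := Finset.mem_erase.1 hk
    rw [leftSign_mul_rightSign hk'.2 hm hk'.1, Finset.erase_right_comm, mul_assoc]

theorem rowMinor_append_of_mem (hq : IsMulAntisymm q) (hX : RowRel q X) {i : Fin n}
    {l : List (Fin n)} (hi : i ∈ l) (J : Finset (Fin n)) : rowMinor q X (l ++ [i]) J = 0 := by
  obtain ⟨c, -, h⟩ := exists_rowMinor_perm hq (List.perm_append_singleton i l)
  rw [h R X hX, rowMinor_cons_of_mem hq hX hi, smul_zero]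

end Minor

/-! ### Quantum matrices -/

section QuantumMatrix

variable {n : ℕ} {R : Type} [Ring R] [Algebra ℂ R]

/-- The conditions on the parameters `p`, `q`, `λ` of the quantum group. -/
structure IsParam (p q : Matrix (Fin n) (Fin n) ℂ) (lam : ℂ) : Prop where
  left : IsMulAntisymm p
  right : IsMulAntisymm q
  mul_eq : ∀ i j, i < j → p i j * q i j = lam
  ne_neg_one : lam ≠ -1

/-- A matrix over `R` satisfies the relations of quantum matrices: its rows act on the `q`-exterior
algebra and its columns on the `p`-exterior algebra. -/
structure IsQuantumMatrix (p q : Matrix (Fin n) (Fin n) ℂ) (X : Matrix (Fin n) (Fin n) R) :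
    Prop where
  row : RowRel q X
  col : RowRel p X.transpose

variable {p q : Matrix (Fin n) (Fin n) ℂ} {lam : ℂ} {X : Matrix (Fin n) (Fin n) R}

/-- The two halves of the relations give a pure commutation rule for the entries in the positions
`(i, l)` and `(j, k)` with `i < j` and `k < l`. This is where `λ ≠ -1` is used. -/
theorem IsQuantumMatrix.antidiagonal_comm (h : IsParam p q lam) (hX : IsQuantumMatrix p q X)
    {i j k l : Fin n} (hij : i < j) (hkl : k < l) :
    q k l • (X i l * X j k) = p i j • (X j k * X i l) := by
  have h1 := hX.row i j k l
  have h2 := hX.col k l i j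
  simp only [Matrix.transpose_apply] at h2
  have ha := h.mul_eq i j hij
  have hb := h.mul_eq k l hkl
  have hne : 1 + lam ≠ 0 := fun h0 => h.ne_neg_one (eq_neg_of_add_eq_zero_right h0)
  -- eliminating `X i k * X j l` from the two relations eliminates `X j l * X i k` as well
  have key : (1 + lam) • (q i j • (X i l * X j k) - p k l • (X j k * X i l)) = 0 := by
    linear_combination (norm := module) q i j • h2 - p k l • h1 +
      ha • (X j l * X i k + p k l • (X j k * X i l)) -
      hb • (X j l * X i k + q i j • (X i l * X j k))
  rw [smul_eq_zero_iff_right hne, sub_eq_zero] at key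
  linear_combination (norm := module) (q k l * q j i) • key -
    (h.right.mul_swap i j) • (q k l • (X i l * X j k) - p i j • (X j k * X i l)) +
    hb • (q j i • (X j k * X i l)) - ha • (q j i • (X j k * X i l))

/-- Expansion along the first column of the minor with the rows `I` in increasing order. Moving an
entry of the first column to the left only passes entries that are above it and further right, so
only `IsQuantumMatrix.antidiagonal_comm` is needed. -/
theorem IsQuantumMatrix.rowMinor_sort_expand_col (h : IsParam p q lam)
    (hX : IsQuantumMatrix p q X) (I : Finset (Fin n)) {J : Finset (Fin n)} {j₀ : Fin n}
    (hj₀ : j₀ ∈ J) (hJ : ∀ j ∈ J, j₀ ≤ j) :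
    rowMinor q X I.sort J =
      ∑ i ∈ I, leftSign p i I • (X i j₀ * rowMinor q X (I.erase i).sort (J.erase j₀)) := by
  induction I using Finset.induction_on_min generalizing J with
  | empty => rw [Finset.sort_empty, rowMinor_nil, if_neg (Finset.ne_empty_of_mem hj₀),
      Finset.sum_empty]
  | insert i I hi ih =>
    have hiI : i ∉ I := fun hm => (hi i hm).false
    rw [Finset.sort_insert _ (fun b hb => (hi b hb).le) hiI, rowMinor_cons,
      Finset.sum_insert hiI, Finset.erase_insert hiI, ← Finset.add_sum_erase J _ hj₀,
      leftSign_eq_one hJ,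
      leftSign_eq_one (J := insert i I) (by simpa using fun k hk => (hi k hk).le)]
    congr 1
    have e1 : ∀ j ∈ J.erase j₀,
        leftSign q j J • (X i j * rowMinor q X I.sort (J.erase j)) =
        ∑ r ∈ I, (leftSign q j J * leftSign p r I) •
          (X i j * X r j₀ * rowMinor q X (I.erase r).sort ((J.erase j).erase j₀)) := by
      intro j hj
      have hj' := Finset.mem_erase.1 hj
      rw [ih (Finset.mem_erase.2 ⟨hj'.1.symm, hj₀⟩)
        (fun k hk => hJ k (Finset.mem_of_mem_erase hk)), Finset.mul_sum, Finset.smul_sum]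
      exact Finset.sum_congr rfl fun r _ => by rw [mul_smul_comm, smul_smul, mul_assoc]
    have e2 : ∀ r ∈ I, leftSign p r (insert i I) •
        (X r j₀ * rowMinor q X ((insert i I).erase r).sort (J.erase j₀)) =
        ∑ j ∈ J.erase j₀, (-p i r * leftSign p r I * leftSign q j (J.erase j₀)) •
          (X r j₀ * X i j * rowMinor q X (I.erase r).sort ((J.erase j).erase j₀)) := by
      intro r hr
      have hir : i ≠ r := (hi r hr).ne
      rw [Finset.erase_insert_of_ne hir, Finset.sort_insert _
        (fun b hb => (hi b (Finset.mem_of_mem_erase hb)).le)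
        (fun hm => hiI (Finset.mem_of_mem_erase hm)), rowMinor_cons,
        leftSign_eq_of_lt (hi r hr) (Finset.mem_insert_self i I), Finset.erase_insert hiI,
        Finset.mul_sum, Finset.smul_sum]
      exact Finset.sum_congr rfl fun j _ => by
        rw [mul_smul_comm, smul_smul, mul_assoc (X r j₀), Finset.erase_right_comm]
    rw [Finset.sum_congr rfl e1, Finset.sum_congr rfl e2, Finset.sum_comm]
    refine Finset.sum_congr rfl fun r hr => Finset.sum_congr rfl fun j hj => ?_
    have hj' := Finset.mem_erase.1 hj
    have hlt : j₀ < j := lt_of_le_of_ne (hJ j hj'.2) hj'.1.symm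
    rw [leftSign_eq_of_lt hlt hj₀]
    have hc := hX.antidiagonal_comm h (hi r hr) hlt
    rw [show -q j₀ j * leftSign q j (J.erase j₀) * leftSign p r I =
        -(leftSign p r I * leftSign q j (J.erase j₀)) * q j₀ j by ring,
      show -p i r * leftSign p r I * leftSign q j (J.erase j₀) =
        -(leftSign p r I * leftSign q j (J.erase j₀)) * p i r by ring,
      mul_smul, mul_smul, ← smul_mul_assoc, ← smul_mul_assoc, hc]
    simp only [smul_mul_assoc]

/-- A quantum minor computed by rows with `q` equals the one computed by columns with `p`. -/
theorem IsQuantumMatrix.rowMinor_sort_transpose (h : IsParam p q lam)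
    (hX : IsQuantumMatrix p q X) (I J : Finset (Fin n)) :
    rowMinor q X I.sort J = rowMinor p X.transpose J.sort I := by
  induction J using Finset.induction_on_min generalizing I with
  | empty =>
    rw [Finset.sort_empty, rowMinor_nil]
    induction I using Finset.induction_on_min with
    | empty => rw [Finset.sort_empty, rowMinor_nil]
    | insert i I hi _ =>
      rw [Finset.sort_insert _ (fun b hb => (hi b hb).le) (fun hm => (hi i hm).false),
        rowMinor_cons, Finset.sum_empty, if_neg (Finset.insert_ne_empty i I)]
  | insert j J hj ih =>
    have hjJ : j ∉ J := fun hm => (hj j hm).false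
    rw [hX.rowMinor_sort_expand_col h I (Finset.mem_insert_self j J)
      (by simpa using fun k hk => (hj k hk).le), Finset.erase_insert hjJ,
      Finset.sort_insert _ (fun b hb => (hj b hb).le) hjJ, rowMinor_cons]
    simp only [ih, Matrix.transpose_apply]

/-! ### The identity matrix, products and images of quantum matrices -/

theorem RowRel.one (hq : IsMulAntisymm q) : RowRel q (1 : Matrix (Fin n) (Fin n) R) := by
  intro i j k l
  have hδ : ∀ a b c d : Fin n, (1 : Matrix (Fin n) (Fin n) R) a b *
      (1 : Matrix (Fin n) (Fin n) R) c d = if a = b ∧ c = d then 1 else 0 := by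
    intro a b c d
    rw [Matrix.one_apply, Matrix.one_apply, ite_and, ite_mul, one_mul, zero_mul]
  have h1 : (1 : Matrix (Fin n) (Fin n) R) j k * (1 : Matrix (Fin n) (Fin n) R) i l =
      (q k l * q i j) • ((1 : Matrix (Fin n) (Fin n) R) i l *
        (1 : Matrix (Fin n) (Fin n) R) j k) := by
    rw [hδ, hδ]
    by_cases h : i = l ∧ j = k
    · obtain ⟨rfl, rfl⟩ := h
      simp [hq.mul_swap]
    · rw [if_neg h, if_neg fun h' => h h'.symm, smul_zero]
  have h2 : q i j • ((1 : Matrix (Fin n) (Fin n) R) i k * (1 : Matrix (Fin n) (Fin n) R) j l) =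
      q k l • ((1 : Matrix (Fin n) (Fin n) R) j l * (1 : Matrix (Fin n) (Fin n) R) i k) := by
    rw [hδ, hδ]
    by_cases h : j = l ∧ i = k
    · obtain ⟨rfl, rfl⟩ := h
      simp
    · rw [if_neg h, if_neg fun h' => h h'.symm, smul_zero, smul_zero]
  rw [h1, h2, smul_add, smul_smul, add_comm]

theorem IsQuantumMatrix.one (hp : IsMulAntisymm p) (hq : IsMulAntisymm q) :
    IsQuantumMatrix p q (1 : Matrix (Fin n) (Fin n) R) :=
  ⟨RowRel.one hq, by rw [Matrix.transpose_one]; exact RowRel.one hp⟩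

/-- The product of two quantum matrices with commuting entries inherits the relations: the
`q`-symmetric products of entries of `G` are paired with `q`-antisymmetric ones of `H`. -/
theorem RowRel.mul {G H : Matrix (Fin n) (Fin n) R} (hG : RowRel q G)
    (hH : RowRel q H) (hc : ∀ i j k l, Commute (G i j) (H k l)) : RowRel q (G * H) := by
  intro i j k l
  let U : Fin n → Fin n → R := fun x y => G j x * G i y + q i j • (G i x * G j y)
  let V : Fin n → Fin n → R := fun x y => H x k * H y l - q k l • (H x l * H y k)
  have hU : ∀ x y, U x y = q x y • U y x := fun x y => hG i j x y
  have hV : ∀ x y, V y x = -(q x y • V x y) := by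
    intro x y
    have := hH x y k l
    simp only [V]
    linear_combination (norm := module) this
  have hUV : ∀ x y, U y x * V y x = -(U x y * V x y) := by
    intro x y
    rw [hV x y, hU x y, mul_neg, mul_smul_comm, smul_mul_assoc]
  have key : ∑ x, ∑ y, U x y * V x y = 0 := by
    have h1 : ∑ x, ∑ y, U x y * V x y = -∑ x, ∑ y, U x y * V x y := by
      conv_lhs => rw [Finset.sum_comm]
      simp only [← Finset.sum_neg_distrib]
      exact Finset.sum_congr rfl fun x _ => Finset.sum_congr rfl fun y _ => hUV x y
    have h2 : (2 : ℂ) • ∑ x, ∑ y, U x y * V x y = 0 := by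
      rw [two_smul]
      exact add_eq_zero_iff_eq_neg.2 h1
    exact (smul_eq_zero_iff_right two_ne_zero).1 h2
  have hexp : ∀ a b c d, (G * H) a c * (G * H) b d =
      ∑ x, ∑ y, G a x * G b y * (H x c * H y d) := by
    intro a b c d
    rw [Matrix.mul_apply, Matrix.mul_apply, Finset.sum_mul_sum]
    refine Finset.sum_congr rfl fun x _ => Finset.sum_congr rfl fun y _ => ?_
    rw [mul_assoc, ← mul_assoc (H x c), ← (hc b y x c).eq]
    simp only [mul_assoc]
  rw [← sub_eq_zero, ← key]
  simp only [hexp, Finset.smul_sum, ← Finset.sum_add_distrib, ← Finset.sum_sub_distrib]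
  refine Finset.sum_congr rfl fun x _ => Finset.sum_congr rfl fun y _ => ?_
  simp only [U, V, add_mul, mul_sub, smul_mul_assoc, mul_smul_comm]

theorem IsQuantumMatrix.mul {G H : Matrix (Fin n) (Fin n) R}
    (hG : IsQuantumMatrix p q G) (hH : IsQuantumMatrix p q H)
    (hc : ∀ i j k l, Commute (G i j) (H k l)) : IsQuantumMatrix p q (G * H) := by
  refine ⟨hG.row.mul hH.row hc, ?_⟩
  have : (G * H).transpose = H.transpose * G.transpose := by
    ext i j
    simp only [Matrix.transpose_apply, Matrix.mul_apply]
    exact Finset.sum_congr rfl fun k _ => (hc j k k i).eq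
  rw [this]
  exact hH.col.mul hG.col fun i j k l => (hc l k j i).symm

theorem RowRel.map {S : Type} [Ring S] [Algebra ℂ S] (f : R →ₐ[ℂ] S) (hX : RowRel q X) :
    RowRel q (X.map f) := by
  intro i j k l
  simpa only [map_add, map_mul, map_smul, Matrix.map_apply] using congrArg f (hX i j k l)

theorem IsQuantumMatrix.map {S : Type} [Ring S] [Algebra ℂ S] (f : R →ₐ[ℂ] S)
    (hX : IsQuantumMatrix p q X) : IsQuantumMatrix p q (X.map f) :=
  ⟨hX.row.map f, hX.col.map f⟩

theorem rowMinor_map {S : Type} [Ring S] [Algebra ℂ S] (f : R →ₐ[ℂ] S) (l : List (Fin n))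
    (J : Finset (Fin n)) : rowMinor q (X.map f) l J = f (rowMinor q X l J) := by
  induction l generalizing J with
  | nil => rw [rowMinor_nil, rowMinor_nil, apply_ite f, map_one, map_zero]
  | cons i l ih => simp only [rowMinor_cons, ih, map_sum, map_smul, map_mul, Matrix.map_apply]

end QuantumMatrix

/-! ### The quantum determinant as a quantum minor -/

section Determinant

variable {n : ℕ} {R : Type} [Ring R] [Algebra ℂ R] {q : Matrix (Fin n) (Fin n) ℂ}
  {X : Matrix (Fin n) (Fin n) R}

theorem rowMinor_of_not_nodup (hq : IsMulAntisymm q) (hX : RowRel q X) {l : List (Fin n)}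
    (hl : ¬l.Nodup) (J : Finset (Fin n)) : rowMinor q X l J = 0 := by
  induction l generalizing J with
  | nil => exact absurd List.nodup_nil hl
  | cons i l ih =>
    by_cases hi : i ∈ l
    · exact rowMinor_cons_of_mem hq hX hi J
    · rw [rowMinor_cons]
      refine Finset.sum_eq_zero fun j _ => ?_
      rw [ih (fun h => hl (List.nodup_cons.2 ⟨hi, h⟩)), mul_zero, smul_zero]

theorem rowMinor_one_cons (i : Fin n) (l : List (Fin n)) {J : Finset (Fin n)} (hi : i ∈ J) :
    rowMinor q (1 : Matrix (Fin n) (Fin n) R) (i :: l) J =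
      leftSign q i J • rowMinor q (1 : Matrix (Fin n) (Fin n) R) l (J.erase i) := by
  rw [rowMinor_cons, Finset.sum_eq_single_of_mem i hi, Matrix.one_apply_eq, one_mul]
  intro j _ hj
  rw [Matrix.one_apply_ne hj.symm, zero_mul, smul_zero]

theorem rowMinor_one_cons_of_notMem (i : Fin n) (l : List (Fin n)) {J : Finset (Fin n)}
    (hi : i ∉ J) : rowMinor q (1 : Matrix (Fin n) (Fin n) R) (i :: l) J = 0 := by
  rw [rowMinor_cons]
  refine Finset.sum_eq_zero fun j hj => ?_
  rw [Matrix.one_apply_ne (ne_of_mem_of_not_mem hj hi).symm, zero_mul, smul_zero]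

theorem rowMinor_one_sort (J : Finset (Fin n)) :
    rowMinor q (1 : Matrix (Fin n) (Fin n) R) J.sort J = 1 := by
  induction J using Finset.induction_on_min with
  | empty => rw [Finset.sort_empty, rowMinor_nil, if_pos rfl]
  | insert j J hj ih =>
    have hjJ : j ∉ J := fun hm => (hj j hm).false
    rw [Finset.sort_insert _ (fun b hb => (hj b hb).le) hjJ,
      rowMinor_one_cons _ _ (Finset.mem_insert_self j J), Finset.erase_insert hjJ, ih,
      leftSign_eq_one (by simpa using fun k hk => (hj k hk).le), one_smul]

/-- The expansion of a quantum minor into monomials. The coefficients are the same minors of the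
matrix `1` over `ℂ`. -/
theorem rowMinor_ofFn {m : ℕ} (r : Fin m → Fin n) (J : Finset (Fin n)) :
    rowMinor q X (List.ofFn r) J = ∑ f : Fin m → Fin n,
      rowMinor q (1 : Matrix (Fin n) (Fin n) ℂ) (List.ofFn f) J •
        (List.ofFn fun i => X (r i) (f i)).prod := by
  induction m generalizing J with
  | zero => simp [rowMinor_nil]
  | succ m ih =>
    rw [List.ofFn_succ, rowMinor_cons,
      ← (Fin.consEquiv fun _ : Fin (m + 1) => Fin n).sum_comp, Fintype.sum_prod_type,
      ← Finset.sum_subset (Finset.subset_univ J)]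
    · refine Finset.sum_congr rfl fun j hj => ?_
      rw [ih, Finset.mul_sum, Finset.smul_sum]
      refine Finset.sum_congr rfl fun f _ => ?_
      simp only [Fin.consEquiv_apply, List.ofFn_succ, Fin.cons_zero, Fin.cons_succ,
        List.prod_cons, rowMinor_one_cons _ _ hj, smul_eq_mul, mul_smul_comm, smul_smul]
    · intro j _ hj
      refine Finset.sum_eq_zero fun f _ => ?_
      have h0 : rowMinor q (1 : Matrix (Fin n) (Fin n) ℂ)
          (List.ofFn ((Fin.consEquiv fun _ : Fin (m + 1) => Fin n) (j, f))) J = 0 := by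
        rw [List.ofFn_succ]
        exact rowMinor_one_cons_of_notMem j _ hj
      rw [h0, zero_smul]

theorem rowMinor_one_ofFn {m : ℕ} (f : Fin m → Fin n) (hf : Function.Injective f) :
    rowMinor q (1 : Matrix (Fin n) (Fin n) ℂ) (List.ofFn f) (Finset.univ.image f) =
      ∏ i, ∏ j, if i < j ∧ f j < f i then -q (f j) (f i) else 1 := by
  induction m with
  | zero => simp [rowMinor_nil]
  | succ m ih =>
    have hf' : Function.Injective fun i : Fin m => f i.succ :=
      hf.comp (Fin.succ_injective m)
    have he : (Finset.univ.image f).erase (f 0) = Finset.univ.image fun i : Fin m => f i.succ := by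
      ext x
      simp only [Finset.mem_erase, Finset.mem_image, Finset.mem_univ, true_and]
      constructor
      · rintro ⟨hx, i, rfl⟩
        obtain ⟨k, rfl⟩ := Fin.exists_succ_eq.2 fun h : i = 0 => hx (by rw [h])
        exact ⟨k, rfl⟩
      · rintro ⟨k, rfl⟩
        exact ⟨fun h => Fin.succ_ne_zero k (hf h), k.succ, rfl⟩
    rw [List.ofFn_succ, rowMinor_one_cons _ _ (Finset.mem_image_of_mem f (Finset.mem_univ 0)), he,
      ih _ hf', Fin.prod_univ_succ, smul_eq_mul]
    congr 1
    · rw [leftSign, Finset.prod_filter, Finset.prod_image fun a _ b _ h => hf h,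
        Fin.prod_univ_succ, Fin.prod_univ_succ]
      simp
    · refine Finset.prod_congr rfl fun i _ => ?_
      rw [Fin.prod_univ_succ]
      simp

theorem rowMinor_one_perm (σ : Equiv.Perm (Fin n)) :
    rowMinor q (1 : Matrix (Fin n) (Fin n) ℂ) (List.ofFn σ) Finset.univ = qInversion q σ := by
  rw [← Finset.image_univ_of_surjective σ.surjective, rowMinor_one_ofFn _ σ.injective,
    qInversion, ← Finset.prod_neg, inversions, Finset.prod_filter,
    Fintype.prod_prod_type]

theorem qDet_eq_rowMinor (hq : IsMulAntisymm q) (X : Matrix (Fin n) (Fin n) R) :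
    qDet q X = rowMinor q X (List.finRange n) Finset.univ := by
  rw [← List.ofFn_id, rowMinor_ofFn, qDet]
  have h : ∀ f ∈ (Finset.univ : Finset (Fin n → Fin n)),
      f ∉ (Finset.univ : Finset (Equiv.Perm (Fin n))).map
        ⟨fun (σ : Equiv.Perm (Fin n)) => (σ : Fin n → Fin n), DFunLike.coe_injective⟩ →
      rowMinor q (1 : Matrix (Fin n) (Fin n) ℂ) (List.ofFn f) Finset.univ •
        (List.ofFn fun i => X (id i) (f i)).prod = 0 := by
    intro f _ hf
    rw [rowMinor_of_not_nodup hq (RowRel.one hq), zero_smul]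
    rw [List.nodup_ofFn]
    intro hinj
    exact hf (Finset.mem_map.2 ⟨Equiv.ofBijective f (Finite.injective_iff_bijective.1 hinj),
      Finset.mem_univ _, rfl⟩)
  rw [← Finset.sum_subset (Finset.subset_univ _) h, Finset.sum_map]
  refine Finset.sum_congr rfl fun σ _ => ?_
  rw [← rowMinor_one_perm]
  rfl

theorem rowMinor_perm (hq : IsMulAntisymm q) (hX : RowRel q X) (σ : Equiv.Perm (Fin n)) :
    rowMinor q X (List.ofFn σ) Finset.univ = qInversion q σ • qDet q X := by
  have hperm : (List.ofFn σ).Perm (List.finRange n) := by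
    refine (List.perm_ext_iff_of_nodup (List.nodup_ofFn.2 σ.injective)
      (List.nodup_finRange n)).2 fun a => ?_
    simp only [List.mem_ofFn, List.mem_finRange, iff_true]
    exact σ.surjective a
  obtain ⟨c, -, hc⟩ := exists_rowMinor_perm hq hperm
  have h1 := hc ℂ 1 (RowRel.one hq) Finset.univ
  rw [rowMinor_one_perm, ← Fin.sort_univ, rowMinor_one_sort, smul_eq_mul, mul_one] at h1
  rw [hc R X hX, h1, qDet_eq_rowMinor hq]

theorem qInversion_ne_zero (hq : IsMulAntisymm q) (σ : Equiv.Perm (Fin n)) :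
    qInversion q σ ≠ 0 :=
  mul_ne_zero (pow_ne_zero _ (neg_ne_zero.2 one_ne_zero))
    (Finset.prod_ne_zero_iff.2 fun _ _ => hq.ne_zero _ _)

end Determinant

/-! ### Representations in which a given quantum minor does not vanish -/

section Elementary

variable {n : ℕ} {R : Type} [Ring R] [Algebra ℂ R] {p q : Matrix (Fin n) (Fin n) ℂ} {lam : ℂ}

/-- The elementary quantum matrix over `2 × 2` matrices: its diagonal entries are
`diag (1, θ_i)`, its entry in position `(a, b)` is the nilpotent matrix unit, all others are zero. -/
def elemMatrix (a b : Fin n) (θ : Fin n → ℂ) :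
    Matrix (Fin n) (Fin n) (Matrix (Fin 2) (Fin 2) ℂ) :=
  fun i j => !![if i = j then 1 else 0, 0; if i = a ∧ j = b then 1 else 0, if i = j then θ i else 0]

theorem elemMatrix_transpose (a b : Fin n) (θ : Fin n → ℂ) :
    (elemMatrix a b θ).transpose = elemMatrix b a θ := by
  ext i j x y
  fin_cases x <;> fin_cases y <;> simp [elemMatrix, eq_comm, and_comm]
  split_ifs with h
  · rw [h]
  · rfl

theorem rowRel_elemMatrix (hq : IsMulAntisymm q) {a b : Fin n} (hab : a ≠ b) {θ : Fin n → ℂ}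
    (hθ : ∀ i, i ≠ b → θ i = q i b * q a i) : RowRel q (elemMatrix a b θ) := by
  intro i j k l
  rcases eq_or_ne k l with rfl | hkl
  · rw [hq.diag, one_smul]
  -- `h1` and `h2` concern the products of diagonal entries, `h3` to `h6` the terms that are linear
  -- in the nilpotent entry; each holds term by term, because `k ≠ l`
  obtain ⟨d, hd⟩ : ∃ d : Fin n → Fin n → ℂ, d = fun i j => if i = j then 1 else 0 := ⟨_, rfl⟩
  obtain ⟨e, he⟩ : ∃ e : Fin n → Fin n → ℂ, e = fun i j => if i = a ∧ j = b then 1 else 0 :=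
    ⟨_, rfl⟩
  have hG : ∀ i j, elemMatrix a b θ i j = !![d i j, 0; e i j, θ i * d i j] := by
    intro i j
    simp only [elemMatrix, hd, he, mul_ite, mul_one, mul_zero]
  have hd0 : ∀ {i j}, i ≠ j → d i j = 0 := fun h => by rw [hd]; exact if_neg h
  have he0 : ∀ {i j}, ¬(i = a ∧ j = b) → e i j = 0 := fun h => by rw [he]; exact if_neg h
  have h1 : d j k * d i l = q k l * q i j * (d i l * d j k) := by
    by_cases h : j = k
    · by_cases h' : i = l
      · subst h h'
        rw [hq.mul_swap, one_mul, mul_comm]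
      · rw [hd0 h', mul_zero, zero_mul, mul_zero]
    · rw [hd0 h, mul_zero, zero_mul, mul_zero]
  have h2 : q i j * (d i k * d j l) = q k l * (d j l * d i k) := by
    by_cases h : j = l
    · by_cases h' : i = k
      · subst h h'
        rw [mul_comm (d i i)]
      · rw [hd0 h', mul_zero, zero_mul, mul_zero, mul_zero]
    · rw [hd0 h, mul_zero, zero_mul, mul_zero, mul_zero]
  have h3 : e j k * d i l = q k l * q i j * θ i * (d i l * e j k) := by
    by_cases h : j = a ∧ k = b
    · by_cases h' : i = l
      · obtain ⟨rfl, rfl⟩ := h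
        subst h'
        rw [hθ i hkl.symm]
        linear_combination (-(e j k * d i i * q i j * q j i)) * hq.mul_swap k i -
          (e j k * d i i) * hq.mul_swap i j
      · rw [hd0 h', mul_zero, zero_mul, mul_zero]
    · rw [he0 h, mul_zero, zero_mul, mul_zero]
  have h4 : θ j * d j k * e i l = q k l * q i j * (e i l * d j k) := by
    by_cases h : i = a ∧ l = b
    · by_cases h' : j = k
      · obtain ⟨rfl, rfl⟩ := h
        subst h'
        rw [hθ j hkl]
        ring
      · rw [hd0 h', mul_zero, zero_mul, mul_zero, mul_zero]
    · rw [he0 h, mul_zero, zero_mul, mul_zero]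
  have h5 : q i j * (e i k * d j l) = q k l * θ j * (d j l * e i k) := by
    by_cases h : i = a ∧ k = b
    · by_cases h' : j = l
      · obtain ⟨rfl, rfl⟩ := h
        subst h'
        rw [hθ j hkl.symm]
        linear_combination (-(q i j * e i k * d j j)) * hq.mul_swap k j
      · rw [hd0 h', mul_zero, zero_mul, mul_zero, mul_zero]
    · rw [he0 h, mul_zero, zero_mul, mul_zero, mul_zero]
  have h6 : q i j * (θ i * d i k * e j l) = q k l * (e j l * d i k) := by
    by_cases h : j = a ∧ l = b
    · by_cases h' : i = k
      · obtain ⟨rfl, rfl⟩ := h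
        subst h'
        rw [hθ i hkl]
        linear_combination (q i l * e j l * d i i) * hq.mul_swap i j
      · rw [hd0 h', mul_zero, mul_zero, zero_mul, mul_zero, mul_zero]
    · rw [he0 h, mul_zero, zero_mul, mul_zero, mul_zero]
  simp only [hG]
  ext x y
  fin_cases x <;> fin_cases y <;> simp
  · linear_combination h1 + h2
  · linear_combination h3 + h4 + h5 + h6
  · linear_combination (θ i * θ j) * h1 + (θ i * θ j) * h2

theorem IsParam.mul_eq_mul (h : IsParam p q lam) {i j k l : Fin n} (hij : i < j) (hkl : k < l) :
    p i j * q i j = p k l * q k l := by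
  rw [h.mul_eq i j hij, h.mul_eq k l hkl]

/-- The scalars `θ_i` that make an elementary matrix a quantum matrix: `q_{ib} q_{ai} = p_{ia} p_{bi}`
for `i ≠ a, b`, and the relations for the rows determine `θ_a`, those for the columns `θ_b`. -/
def elemScalar (p q : Matrix (Fin n) (Fin n) ℂ) (a b i : Fin n) : ℂ :=
  if i = b then p b a else q i b * q a i

theorem elemScalar_ne_zero (h : IsParam p q lam) (a b i : Fin n) : elemScalar p q a b i ≠ 0 := by
  unfold elemScalar
  split_ifs
  · exact h.left.ne_zero _ _
  · exact mul_ne_zero (h.right.ne_zero _ _) (h.right.ne_zero _ _)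

/-- The two indices have to be adjacent: an index strictly between them would impose `λ = 1`. -/
theorem isQuantumMatrix_elemMatrix (h : IsParam p q lam) {a b : Fin n}
    (hab : (a : ℕ) + 1 = b ∨ (b : ℕ) + 1 = a) :
    IsQuantumMatrix p q (elemMatrix a b (elemScalar p q a b)) := by
  have hne : a ≠ b := by rintro rfl; omega
  refine ⟨rowRel_elemMatrix h.right hne fun i hi => if_neg hi, ?_⟩
  rw [elemMatrix_transpose]
  refine rowRel_elemMatrix h.left hne.symm fun i hi => ?_
  unfold elemScalar
  split_ifs with hb
  · rw [hb, h.left.diag, mul_one]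
  · have e : p i a * q i a = p i b * q i b := by
      rcases lt_or_gt_of_ne hi with h1 | h1
      · exact h.mul_eq_mul h1 (by omega)
      · have h2 : b < i := by omega
        have e := h.mul_eq_mul h1 h2
        have := h.left.ne_zero a i
        have := h.left.ne_zero b i
        have := h.right.ne_zero a i
        have := h.right.ne_zero b i
        have ea := eq_inv_of_mul_eq_one_left (h.left.mul_swap i a)
        have eb := eq_inv_of_mul_eq_one_left (h.left.mul_swap i b)
        have ea' := eq_inv_of_mul_eq_one_left (h.right.mul_swap i a)
        have eb' := eq_inv_of_mul_eq_one_left (h.right.mul_swap i b)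
        rw [ea, eb, ea', eb', ← mul_inv, ← mul_inv, e]
    linear_combination (-q a i * p b i) * e - (q a i * q i b) * h.left.mul_swap i b
      + (p i a * p b i) * h.right.mul_swap a i

/-- The product of an elementary quantum matrix with `X`. -/
def elemMul (a b : Fin n) (θ : Fin n → ℂ) (X : Matrix (Fin n) (Fin n) R) :
    Matrix (Fin n) (Fin n) (Matrix (Fin 2) (Fin 2) R) :=
  (elemMatrix a b θ).map (Algebra.ofId ℂ R).mapMatrix * X.map (Matrix.scalarAlgHom (Fin 2) ℂ)

theorem IsQuantumMatrix.elemMul (h : IsParam p q lam) {a b : Fin n}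
    (hab : (a : ℕ) + 1 = b ∨ (b : ℕ) + 1 = a) {X : Matrix (Fin n) (Fin n) R}
    (hX : IsQuantumMatrix p q X) :
    IsQuantumMatrix p q (elemMul a b (elemScalar p q a b) X) := by
  refine ((isQuantumMatrix_elemMatrix h hab).map _).mul (hX.map _) fun i j k l => ?_
  ext x y
  simp [Matrix.scalarAlgHom, Matrix.scalar_apply, Matrix.mul_diagonal, Matrix.diagonal_mul,
    Algebra.commutes, Algebra.ofId_apply]

theorem elemMul_apply (a b : Fin n) (θ : Fin n → ℂ)
    (X : Matrix (Fin n) (Fin n) R) (i j : Fin n) :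
    elemMul a b θ X i j = !![X i j, 0; if i = a then X b j else 0, θ i • X i j] := by
  rw [elemMul, Matrix.mul_apply]
  ext x y
  rw [Matrix.sum_apply]
  fin_cases x <;> fin_cases y <;>
    simp [elemMatrix, Matrix.scalarAlgHom, Matrix.scalar_apply, Matrix.mul_diagonal,
      Algebra.ofId_apply, apply_ite (algebraMap ℂ R), Algebra.smul_def]
  by_cases h : i = a <;> simp [h]

end Elementary

section NonVanishing

variable {n : ℕ} {R : Type} [Ring R] [Algebra ℂ R] {p q : Matrix (Fin n) (Fin n) ℂ} {lam : ℂ}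

theorem sum_smul_fin_two {ι : Type*} (s : Finset ι) (c : ι → ℂ) (A B C D : ι → R) :
    ∑ i ∈ s, c i • !![A i, B i; C i, D i] =
      !![∑ i ∈ s, c i • A i, ∑ i ∈ s, c i • B i; ∑ i ∈ s, c i • C i, ∑ i ∈ s, c i • D i] := by
  ext x y
  rw [Matrix.sum_apply]
  fin_cases x <;> fin_cases y <;> simp

theorem rowMinor_elemMul_of_notMem {a b : Fin n} (θ : Fin n → ℂ) (X : Matrix (Fin n) (Fin n) R)
    {l : List (Fin n)} (ha : a ∉ l) (J : Finset (Fin n)) :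
    rowMinor q (elemMul a b θ X) l J =
      !![rowMinor q X l J, 0; 0, (l.map θ).prod • rowMinor q X l J] := by
  induction l generalizing J with
  | nil =>
    simp only [rowMinor_nil, List.map_nil, List.prod_nil, one_smul]
    split_ifs
    · exact Matrix.one_fin_two
    · ext x y
      fin_cases x <;> fin_cases y <;> rfl
  | cons i l ih =>
    rw [List.mem_cons, not_or] at ha
    simp only [rowMinor_cons, ih ha.2, elemMul_apply, if_neg (Ne.symm ha.1), Matrix.mul_fin_two,
      mul_zero, zero_mul, add_zero, zero_add, sum_smul_fin_two, smul_zero,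
      Finset.sum_const_zero, List.map_cons, List.prod_cons, Finset.smul_sum]
    congr! 6 with j
    rw [smul_mul_smul_comm, smul_comm]

/-- The minors of an elementary quantum matrix times `X`: the lower left entry is the minor of `X`
with the row `a` replaced by the row `b`. -/
theorem exists_rowMinor_elemMul {a b : Fin n} {θ : Fin n → ℂ} (hθ : ∀ i, θ i ≠ 0)
    {l : List (Fin n)} (hl : l.Nodup) (ha : a ∈ l) :
    ∃ c : ℂ, c ≠ 0 ∧ ∀ (X : Matrix (Fin n) (Fin n) R) (J : Finset (Fin n)),
      rowMinor q (elemMul a b θ X) l J =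
        !![rowMinor q X l J, 0;
          c • rowMinor q X (l.map fun i => if i = a then b else i) J,
          (l.map θ).prod • rowMinor q X l J] := by
  induction l with
  | nil => exact absurd ha List.not_mem_nil
  | cons i l ih =>
    obtain ⟨hi, hl'⟩ := List.nodup_cons.1 hl
    by_cases hia : i = a
    · subst hia
      refine ⟨1, one_ne_zero, fun X J => ?_⟩
      have hmap : (l.map fun k => if k = i then b else k) = l := by
        conv_rhs => rw [← List.map_id l]
        exact List.map_congr_left fun k hk => if_neg (ne_of_mem_of_not_mem hk hi)
      simp only [rowMinor_cons, rowMinor_elemMul_of_notMem θ X hi, elemMul_apply, if_true,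
        Matrix.mul_fin_two, mul_zero, zero_mul, add_zero, zero_add, sum_smul_fin_two,
        smul_zero, Finset.sum_const_zero, List.map_cons, List.prod_cons, Finset.smul_sum, hmap,
        one_smul]
      congr! 6 with j
      rw [smul_mul_smul_comm, smul_comm]
    · obtain ⟨c, hc, h⟩ := ih hl' ((List.mem_cons.1 ha).resolve_left (Ne.symm hia))
      refine ⟨θ i * c, mul_ne_zero (hθ i) hc, fun X J => ?_⟩
      simp only [rowMinor_cons, h, elemMul_apply, if_neg hia, Matrix.mul_fin_two,
        mul_zero, zero_mul, add_zero, zero_add, sum_smul_fin_two, smul_zero,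
        Finset.sum_const_zero, List.map_cons, List.prod_cons, Finset.smul_sum]
      refine congrArg₂ (fun u v => !![_, 0; u, v]) (Finset.sum_congr rfl fun j _ => ?_)
        (Finset.sum_congr rfl fun j _ => ?_) <;>
      rw [smul_mul_smul_comm, smul_comm]

theorem isUnit_lowerTriangular {S : Type} [Ring S] {x y : S} (hx : IsUnit x) (hy : IsUnit y)
    (z : S) : IsUnit (!![x, 0; z, y] : Matrix (Fin 2) (Fin 2) S) := by
  obtain ⟨x, rfl⟩ := hx
  obtain ⟨y, rfl⟩ := hy
  refine ⟨⟨!![↑x, 0; z, ↑y], !![↑x⁻¹, 0; -(↑y⁻¹ * z * ↑x⁻¹), ↑y⁻¹], ?_, ?_⟩, rfl⟩ <;>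
    simp [Matrix.one_fin_two, mul_assoc]

/-- Some quantum matrix over some ring has an invertible quantum determinant and a nonzero quantum
minor with the rows `I` and the columns `J`. -/
def HasNonzeroMinor (p q : Matrix (Fin n) (Fin n) ℂ) (I J : Finset (Fin n)) : Prop :=
  ∃ (R : Type) (_ : Ring R) (_ : Algebra ℂ R) (X : Matrix (Fin n) (Fin n) R),
    IsQuantumMatrix p q X ∧ IsUnit (qDet q X) ∧ rowMinor q X I.sort J ≠ 0

theorem HasNonzeroMinor.refl (h : IsParam p q lam) (J : Finset (Fin n)) :
    HasNonzeroMinor p q J J := by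
  refine ⟨ℂ, inferInstance, inferInstance, 1, .one h.left h.right, ?_, ?_⟩
  · rw [qDet_eq_rowMinor h.right, ← Fin.sort_univ, rowMinor_one_sort]
    exact isUnit_one
  · rw [rowMinor_one_sort]
    exact one_ne_zero

/-- Multiplication by an elementary quantum matrix replaces a row of a nonzero minor. -/
theorem HasNonzeroMinor.replace_row (h : IsParam p q lam) {I J : Finset (Fin n)} {a b : Fin n}
    (hab : (a : ℕ) + 1 = b ∨ (b : ℕ) + 1 = a) (ha : a ∈ I) (hb : b ∉ I)
    (hI : HasNonzeroMinor p q (insert b (I.erase a)) J) : HasNonzeroMinor p q I J := by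
  obtain ⟨R, _, _, X, hX, hU, h0⟩ := hI
  have hθ := elemScalar_ne_zero h a b
  refine ⟨_, inferInstance, inferInstance, _, hX.elemMul h hab, ?_, ?_⟩
  · obtain ⟨c, -, hc⟩ := exists_rowMinor_elemMul (R := R) (q := q) (b := b) hθ
      (List.nodup_finRange n) (List.mem_finRange a)
    rw [qDet_eq_rowMinor h.right, hc, ← qDet_eq_rowMinor h.right]
    have h0 : ((List.finRange n).map (elemScalar p q a b)).prod ≠ 0 := by
      rw [Ne, List.prod_eq_zero_iff, List.mem_map]
      rintro ⟨i, -, hi⟩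
      exact hθ i hi
    refine isUnit_lowerTriangular hU ?_ _
    rw [Algebra.smul_def]
    exact ((IsUnit.mk0 _ h0).map (algebraMap ℂ R)).mul hU
  · obtain ⟨c, hc0, hc⟩ := exists_rowMinor_elemMul (R := R) (q := q) (b := b) hθ
      (I.sort_nodup (· ≤ ·)) ((Finset.mem_sort _).2 ha)
    have hinj : Set.InjOn (fun i => if i = a then b else i) {i | i ∈ I.sort} := by
      intro i hi k hk hik
      simp only [Set.mem_ofPred_eq, Finset.mem_sort] at hi hk
      grind
    have hperm : (I.sort.map fun i => if i = a then b else i).Perm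
        (insert b (I.erase a)).sort := by
      refine (List.perm_ext_iff_of_nodup ((List.nodup_map_iff_inj_on (I.sort_nodup _)).2
        hinj) (Finset.sort_nodup _ _)).2 fun i => ?_
      simp only [List.mem_map, Finset.mem_sort, Finset.mem_insert, Finset.mem_erase]
      grind
    obtain ⟨d, hd0, hd⟩ := exists_rowMinor_perm h.right hperm
    rw [hc]
    intro h1
    have h2 : c • rowMinor q X (I.sort.map fun i => if i = a then b else i) J = 0 :=
      congrFun (congrFun h1 1) 0
    rw [hd R X hX.row, smul_smul, smul_eq_zero_iff_right (mul_ne_zero hc0 hd0)] at h2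
    exact h0 h2

/-- A finite set of indices can be moved to an initial segment by steps that replace an index by its
predecessor. -/
theorem exists_isLowerSet_of_step {P : Finset (Fin n) → Prop}
    (hP : ∀ (I : Finset (Fin n)) (a b : Fin n), ((a : ℕ) + 1 = b ∨ (b : ℕ) + 1 = a) → a ∈ I →
      b ∉ I → P (insert b (I.erase a)) → P I) (I : Finset (Fin n)) :
    ∃ I₀ : Finset (Fin n), IsLowerSet (I₀ : Set (Fin n)) ∧ I₀.card = I.card ∧ (P I ↔ P I₀) := by
  induction hm : ∑ i ∈ I, (i : ℕ) using Nat.strong_induction_on generalizing I with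
  | _ m ih =>
    by_cases hI : ∃ a b : Fin n, (b : ℕ) + 1 = a ∧ a ∈ I ∧ b ∉ I
    · obtain ⟨a, b, hab, ha, hb⟩ := hI
      have hb' : b ∉ I.erase a := fun h => hb (Finset.mem_of_mem_erase h)
      have hba : b ≠ a := fun h => hb (h ▸ ha)
      obtain ⟨I₀, h0, h1, h2⟩ := ih (∑ i ∈ insert b (I.erase a), (i : ℕ)) (by
        rw [Finset.sum_insert hb', ← hm, ← Finset.add_sum_erase I _ ha]
        omega) (insert b (I.erase a)) rfl
      refine ⟨I₀, h0, ?_, ?_⟩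
      · rw [h1, Finset.card_insert_of_notMem hb', Finset.card_erase_add_one ha]
      · rw [← h2]
        refine ⟨fun h => hP _ b a (Or.inl hab) (Finset.mem_insert_self _ _) ?_ ?_,
          hP I a b (Or.inr hab) ha hb⟩
        · simp [hba.symm]
        · rwa [Finset.erase_insert hb', Finset.insert_erase ha]
    · push Not at hI
      refine ⟨I, ?_, rfl, Iff.rfl⟩
      have key : ∀ d : ℕ, ∀ x y : Fin n, (x : ℕ) + d = y → y ∈ I → x ∈ I := by
        intro d
        induction d with
        | zero =>
          intro x y h hy
          rwa [Fin.ext (show (x : ℕ) = y by omega)]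
        | succ d ihd =>
          intro x y h hy
          exact ihd x ⟨x + d, by omega⟩ rfl (hI y ⟨x + d, by omega⟩ (by simp; omega) hy)
      intro y x hxy hy
      exact key (y - x) x y (by have : (x : ℕ) ≤ y := hxy; omega) hy

theorem hasNonzeroMinor (h : IsParam p q lam) {I J : Finset (Fin n)} (hIJ : I.card = J.card) :
    HasNonzeroMinor p q I J := by
  have hP := fun I a b => HasNonzeroMinor.replace_row h (I := I) (J := J) (a := a) (b := b)
  obtain ⟨I₀, hI₀, hIc, hI⟩ := exists_isLowerSet_of_step (P := fun I => HasNonzeroMinor p q I J) hP I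
  obtain ⟨J₀, hJ₀, hJc, hJ⟩ := exists_isLowerSet_of_step (P := fun I => HasNonzeroMinor p q I J) hP J
  have e : I₀ = J₀ := by
    rcases hI₀.total hJ₀ with hs | hs
    · exact Finset.eq_of_subset_of_card_le (by exact_mod_cast hs) (by omega)
    · exact (Finset.eq_of_subset_of_card_le (by exact_mod_cast hs) (by omega)).symm
  rw [hI, e, ← hJ]
  exact .refl h J

end NonVanishing

/-! ### Universal properties, and the invertibility of the quantum minors -/

section Universal

section Lift

variable {R T : Type} [Ring R] [Algebra ℂ R] [Ring T] [Algebra ℂ T]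

/-- The universal property of the localization. -/
theorem exists_loc_lift (S : Set R) (f : R →ₐ[ℂ] T) (hf : ∀ s ∈ S, IsUnit (f s)) :
    ∃ g : Loc S →ₐ[ℂ] T, ∀ r, g (Loc.of S r) = f r := by
  let φ : FreeAlgebra ℂ (LocGen S) →ₐ[ℂ] T := FreeAlgebra.lift ℂ fun x =>
    match x with
    | .elt r => f r
    | .inv s => Ring.inverse (f s)
  have h1 : ∀ r, φ (LocGen.eltWord S r) = f r := fun r => FreeAlgebra.lift_ι_apply _ _
  have h2 : ∀ s, φ (LocGen.invWord S s) = Ring.inverse (f s) :=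
    fun s => FreeAlgebra.lift_ι_apply _ _
  have hφ : ∀ ⦃x y⦄, LocRel S x y → φ x = φ y := by
    intro x y hxy
    induction hxy with
    | add x y => simp only [map_add, h1]
    | mul x y => simp only [map_mul, h1]
    | scalar c => rw [h1, AlgHom.commutes, AlgHom.commutes]
    | mul_inv s => rw [map_mul, h1, h2, map_one, Ring.mul_inverse_cancel _ (hf s s.2)]
    | inv_mul s => rw [map_mul, h1, h2, map_one, Ring.inverse_mul_cancel _ (hf s s.2)]
  refine ⟨RingQuot.liftAlgHom ℂ ⟨φ, hφ⟩, fun r => ?_⟩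
  rw [← h1]
  exact RingQuot.liftAlgHom_mkAlgHom_apply _ φ hφ _

end Lift

variable {n : ℕ} {R : Type} [Ring R] [Algebra ℂ R] {p q : Matrix (Fin n) (Fin n) ℂ} {lam : ℂ}

theorem RowRel.row_comm {X : Matrix (Fin n) (Fin n) R} (hq : IsMulAntisymm q) (hX : RowRel q X)
    (i k l : Fin n) : X i k * X i l = q k l • (X i l * X i k) := by
  have h := hX i i k l
  rw [hq.diag, one_smul, one_smul, ← two_smul ℂ, ← two_smul ℂ, smul_comm] at h
  have h2 : (2 : ℂ) • (X i k * X i l - q k l • (X i l * X i k)) = 0 := by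
    rw [smul_sub, h, sub_self]
  exact sub_eq_zero.1 ((smul_eq_zero_iff_right two_ne_zero).1 h2)

theorem RowRel.cross {X : Matrix (Fin n) (Fin n) R} (hq : IsMulAntisymm q) (hX : RowRel q X)
    (i j k l : Fin n) : X i k * X j l - (q k l / q i j) • (X j l * X i k) =
      q k l • (X i l * X j k) - (1 / q i j) • (X j k * X i l) := by
  have h := hX i j k l
  have hne := hq.ne_zero i j
  have h' := congrArg (fun x => (q i j)⁻¹ • x) h
  simp only [smul_add, smul_smul, inv_mul_cancel₀ hne, one_smul] at h'
  rw [show (q i j)⁻¹ * (q k l * q i j) = q k l by field_simp] at h'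
  rw [div_eq_inv_mul, one_div]
  linear_combination (norm := module) h'

/-- The ordered relations of the definition of `𝒜` imply the unordered ones. -/
theorem RowRel.of_lt {X : Matrix (Fin n) (Fin n) R} (hq : IsMulAntisymm q)
    (hrow : ∀ i k l, k < l → X i k * X i l = q k l • (X i l * X i k))
    (hcross : ∀ i j k l, i < j → k < l →
      X i k * X j l - (q k l / q i j) • (X j l * X i k) =
        q k l • (X i l * X j k) - (1 / q i j) • (X j k * X i l)) : RowRel q X := by
  have hrow' : ∀ i k l, X i k * X i l = q k l • (X i l * X i k) := by
    intro i k l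
    rcases lt_trichotomy k l with h | rfl | h
    · exact hrow i k l h
    · rw [hq.diag, one_smul]
    · rw [hrow i l k h, smul_smul, hq.mul_swap, one_smul]
  have hlt : ∀ i j k l, i < j → k < l → X j k * X i l + q i j • (X i k * X j l) =
      q k l • (X j l * X i k + q i j • (X i l * X j k)) := by
    intro i j k l hij hkl
    have hne := hq.ne_zero i j
    have h := congrArg (fun x => q i j • x) (hcross i j k l hij hkl)
    simp only [smul_sub, smul_smul, mul_one_div_cancel hne, one_smul, mul_div_cancel₀ _ hne] at h
    linear_combination (norm := module) h
  have hk : ∀ i j k l, i < j → X j k * X i l + q i j • (X i k * X j l) =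
      q k l • (X j l * X i k + q i j • (X i l * X j k)) := by
    intro i j k l hij
    rcases lt_trichotomy k l with h | rfl | h
    · exact hlt i j k l hij h
    · rw [hq.diag, one_smul]
    · rw [hlt i j l k hij h, smul_smul, hq.mul_swap, one_smul]
  intro i j k l
  rcases lt_trichotomy i j with h | rfl | h
  · exact hk i j k l h
  · rw [hrow' i k l, smul_comm, ← smul_add]
  · have e := congrArg (fun x => q i j • x) (hk j i k l h)
    have s := hq.mul_swap i j
    linear_combination (norm := module) e - s • (X j k * X i l) + s • (q k l • (X j l * X i k))

theorem QMat.gen_isQuantumMatrix (hp : IsMulAntisymm p) (hq : IsMulAntisymm q) :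
    IsQuantumMatrix p q (QMat.gen p q) := by
  have hrel : ∀ {x y}, MatRel p q x y →
      RingQuot.mkAlgHom ℂ (MatRel p q) x = RingQuot.mkAlgHom ℂ (MatRel p q) y :=
    fun h => RingQuot.mkAlgHom_rel ℂ h
  constructor
  · refine RowRel.of_lt hq (fun i k l h => ?_) fun i j k l hij hkl => ?_
    · have := hrel (MatRel.row i k l h)
      rw [map_mul, map_smul, map_mul] at this
      exact this
    · have := hrel (MatRel.crossQ i j k l hij hkl)
      simp only [map_sub, map_smul, map_mul] at this
      exact this
  · refine RowRel.of_lt hp (fun i k l h => ?_) fun i j k l hij hkl => ?_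
    · have := hrel (MatRel.col k l i h)
      rw [map_mul, map_smul, map_mul] at this
      exact this
    · have := hrel (MatRel.crossP k l i j hkl hij)
      simp only [map_sub, map_smul, map_mul] at this
      exact this

/-- The universal property of the algebra of quantum matrices. -/
theorem exists_qMat_lift (hp : IsMulAntisymm p) (hq : IsMulAntisymm q)
    {X : Matrix (Fin n) (Fin n) R} (hX : IsQuantumMatrix p q X) :
    ∃ f : QMat p q →ₐ[ℂ] R, (QMat.gen p q).map f = X := by
  let φ : FreeAlgebra ℂ (Fin n × Fin n) →ₐ[ℂ] R := FreeAlgebra.lift ℂ fun x => X x.1 x.2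
  have h1 : ∀ i j, φ (freeGen i j) = X i j := fun i j => FreeAlgebra.lift_ι_apply _ _
  have hφ : ∀ ⦃x y⦄, MatRel p q x y → φ x = φ y := by
    intro x y hxy
    induction hxy with
    | row i k l _ =>
      simp only [map_mul, map_smul, h1]
      exact hX.row.row_comm hq i k l
    | col i j k _ =>
      simp only [map_mul, map_smul, h1]
      exact hX.col.row_comm hp k i j
    | crossQ i j k l _ _ =>
      simp only [map_mul, map_smul, map_sub, h1]
      exact hX.row.cross hq i j k l
    | crossP i j k l _ _ =>
      simp only [map_mul, map_smul, map_sub, h1]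
      exact hX.col.cross hp k l i j
  refine ⟨RingQuot.liftAlgHom ℂ ⟨φ, hφ⟩, ?_⟩
  ext i j
  rw [Matrix.map_apply, ← h1]
  exact RingQuot.liftAlgHom_mkAlgHom_apply _ φ hφ _

theorem qDet_map {S : Type} [Ring S] [Algebra ℂ S] (hq : IsMulAntisymm q) (f : R →ₐ[ℂ] S)
    (X : Matrix (Fin n) (Fin n) R) : qDet q (X.map f) = f (qDet q X) := by
  rw [qDet_eq_rowMinor hq, qDet_eq_rowMinor hq, rowMinor_map]

theorem QFrac.gen_isQuantumMatrix (h : IsParam p q lam) :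
    IsQuantumMatrix p q (QFrac.gen p q) :=
  ((QMat.gen_isQuantumMatrix h.left h.right).map _).map _

/-- The quantum minors do not vanish in the quantum group, since the representations of
`hasNonzeroMinor` extend to it. -/
theorem QGL.rowMinor_ne_zero (h : IsParam p q lam) {I J : Finset (Fin n)}
    (hIJ : I.card = J.card) : rowMinor q (QGL.gen p q) I.sort J ≠ 0 := by
  obtain ⟨R, _, _, X, hX, hU, h0⟩ := hasNonzeroMinor h hIJ
  obtain ⟨f, hf⟩ := exists_qMat_lift h.left h.right hX
  obtain ⟨g, hg⟩ := exists_loc_lift {QMat.det p q} f (by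
    rintro _ rfl
    rwa [QMat.det, ← qDet_map h.right, hf])
  intro h1
  apply h0
  have hgX : (QGL.gen p q).map g = X := by
    rw [← hf]
    ext i j
    exact hg _
  rw [← hgX, rowMinor_map, h1, map_zero]

/-- All the quantum minors of the generating matrix are invertible in the ring of fractions. -/
theorem QFrac.isUnit_rowMinor (h : IsParam p q lam) {I J : Finset (Fin n)}
    (hIJ : I.card = J.card) : IsUnit (rowMinor q (QFrac.gen p q) I.sort J) := by
  rw [QFrac.gen, rowMinor_map]
  exact Loc.isUnit_of {x : QGL p q | x ≠ 0} ⟨_, QGL.rowMinor_ne_zero h hIJ⟩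

end Universal

/-! ### Inverses of submatrices and quasideterminants -/

section Inverse

theorem quasidet_eq_of_isMatInverse {A B : Type} [Fintype A] [Fintype B] [DecidableEq A]
    [DecidableEq B] {L : Type} [Ring L] {M : Matrix A B L} {Y : Matrix B A L} (hY : IsMatInverse M Y) (i : A) (j : B) :
    quasidet M i j = Ring.inverse (Y j i) := by
  have h : ∃ Y, IsMatInverse M Y := ⟨Y, hY⟩
  have e : h.choose = Y := by
    rw [← Matrix.mul_one h.choose, ← hY.1, ← Matrix.mul_assoc, h.choose_spec.2, Matrix.one_mul]
  rw [quasidet, dif_pos h, e]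

variable {n : ℕ} {K : Type} [Ring K] [Algebra ℂ K] {p q : Matrix (Fin n) (Fin n) ℂ} {lam : ℂ}
  {X : Matrix (Fin n) (Fin n) K}

/-- All the quantum minors of `X` with increasing rows are invertible. -/
def HasUnitMinors (q : Matrix (Fin n) (Fin n) ℂ) (X : Matrix (Fin n) (Fin n) K) : Prop :=
  ∀ I J : Finset (Fin n), I.card = J.card → IsUnit (rowMinor q X I.sort J)

theorem isUnit_smul_of_ne_zero {c : ℂ} (hc : c ≠ 0) {x : K} (hx : IsUnit x) : IsUnit (c • x) := by
  rw [Algebra.smul_def]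
  exact ((IsUnit.mk0 c hc).map (algebraMap ℂ K)).mul hx

theorem ringInverse_smul {c : ℂ} (hc : c ≠ 0) (u : Kˣ) :
    Ring.inverse (c • (u : K)) = c⁻¹ • (u⁻¹ : Kˣ) := by
  have h : c • (u : K) = ((Units.mk0 c hc) • u : Kˣ) := rfl
  rw [h, Ring.inverse_unit]
  rfl

theorem perm_sort_toFinset {l : List (Fin n)} (hl : l.Nodup) : l.Perm l.toFinset.sort :=
  (List.perm_ext_iff_of_nodup hl (Finset.sort_nodup _ _)).2 fun a => by simp

theorem HasUnitMinors.isUnit_rowMinor (hq : IsMulAntisymm q) (hX : RowRel q X)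
    (hU : HasUnitMinors q X) {l : List (Fin n)} (hl : l.Nodup) {J : Finset (Fin n)}
    (hlJ : l.toFinset.card = J.card) : IsUnit (rowMinor q X l J) := by
  obtain ⟨c, hc, h⟩ := exists_rowMinor_perm hq (perm_sort_toFinset hl)
  rw [h K X hX]
  exact isUnit_smul_of_ne_zero hc (hU _ _ hlJ)

theorem HasUnitMinors.transpose (h : IsParam p q lam) (hX : IsQuantumMatrix p q X)
    (hU : HasUnitMinors q X) : HasUnitMinors p X.transpose := fun I J hIJ => by
  rw [← hX.rowMinor_sort_transpose h]
  exact hU J I hIJ.symm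

theorem rowMinor_one_ne_zero (hq : IsMulAntisymm q) {l : List (Fin n)} (hl : l.Nodup) :
    rowMinor q (1 : Matrix (Fin n) (Fin n) ℂ) l l.toFinset ≠ 0 := by
  obtain ⟨c, hc, h⟩ := exists_rowMinor_perm hq (perm_sort_toFinset hl)
  rwa [h ℂ 1 (RowRel.one hq), rowMinor_one_sort, smul_eq_mul, mul_one]

theorem toFinset_cons_sort_erase {i : Fin n} {I : Finset (Fin n)} (hi : i ∈ I) :
    (i :: (I.erase i).sort).toFinset = I := by
  rw [List.toFinset_cons, Finset.sort_toFinset, Finset.insert_erase hi]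

theorem nodup_cons_sort_erase (i : Fin n) (I : Finset (Fin n)) :
    (i :: (I.erase i).sort).Nodup :=
  List.nodup_cons.2 ⟨by simp, Finset.sort_nodup _ _⟩

section Submatrix

/-- The submatrix with the rows in `P` and the columns in `Q`. -/
abbrev restrict {α : Type} (P Q : Fin n → Prop) (X : Matrix (Fin n) (Fin n) α) :
    Matrix {i // P i} {j // Q j} α := X.submatrix Subtype.val Subtype.val

theorem restrict_apply {α : Type} (P Q : Fin n → Prop) (X : Matrix (Fin n) (Fin n) α) (i : {i // P i})
    (j : {j // Q j}) : restrict P Q X i j = X i j := rfl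

/-- The matrix whose entries with `j ∈ J` and `i ∈ I` form the right inverse of the submatrix of `X`
with the rows `I` and the columns `J` that is given by expansion along the first row. -/
def rightInv (q : Matrix (Fin n) (Fin n) ℂ) (X : Matrix (Fin n) (Fin n) K)
    (I J : Finset (Fin n)) : Matrix (Fin n) (Fin n) K := fun j i =>
  leftSign q j J • (rowMinor q X (I.erase i).sort (J.erase j) *
    Ring.inverse (rowMinor q X (i :: (I.erase i).sort) J))

/-- The matrix whose entries with `j ∈ J` and `i ∈ I` form the left inverse of the submatrix of `X`
with the rows `I` and the columns `J` that is given by expansion along the last column. -/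
def leftInv (p : Matrix (Fin n) (Fin n) ℂ) (X : Matrix (Fin n) (Fin n) K)
    (I J : Finset (Fin n)) : Matrix (Fin n) (Fin n) K := fun j i =>
  rightSign p i I •
    (Ring.inverse (rowMinor p X.transpose ((J.erase j).sort ++ [j]) I) *
      rowMinor p X.transpose (J.erase j).sort (I.erase i))

theorem isUnit_rightInv_apply (hq : IsMulAntisymm q) (hX : RowRel q X)
    (hU : HasUnitMinors q X)
    {I J : Finset (Fin n)} (hIJ : I.card = J.card) {i j : Fin n} (hi : i ∈ I) (hj : j ∈ J) :
    IsUnit (rightInv q X I J j i) := by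
  refine isUnit_smul_of_ne_zero (leftSign_ne_zero hq _ _) ((hU _ _ ?_).mul (IsUnit.ringInverse
    (hU.isUnit_rowMinor hq hX (nodup_cons_sort_erase _ _) ?_)))
  · rw [Finset.card_erase_of_mem hi, Finset.card_erase_of_mem hj, hIJ]
  · rw [toFinset_cons_sort_erase hi, hIJ]

variable {P Q : Fin n → Prop} {I J : Finset (Fin n)}

theorem submatrix_mul_rightInv [Fintype {j // Q j}] (hq : IsMulAntisymm q) (hX : RowRel q X) (hU : HasUnitMinors q X)
    (hI : ∀ i, i ∈ I ↔ P i) (hJ : ∀ j, j ∈ J ↔ Q j) (hIJ : I.card = J.card) :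
    restrict P Q X * restrict Q P (rightInv q X I J) = 1 := by
  ext i i'
  have e : (restrict P Q X * restrict Q P (rightInv q X I J)) i i' = rowMinor q X (i :: (I.erase (i' : Fin n)).sort) J *
        Ring.inverse (rowMinor q X (i' :: (I.erase (i' : Fin n)).sort) J) := by
    rw [Matrix.mul_apply, rowMinor_cons, Finset.sum_mul, Finset.sum_subtype J hJ]
    refine Finset.sum_congr rfl fun j _ => ?_
    simp only [rightInv, Matrix.submatrix_apply, mul_smul_comm, smul_mul_assoc, mul_assoc]
  rw [e]
  by_cases h : i = i'
  · rw [h, Matrix.one_apply_eq]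
    exact Ring.mul_inverse_cancel _ (hU.isUnit_rowMinor hq hX (nodup_cons_sort_erase _ _)
      (by rw [toFinset_cons_sort_erase ((hI _).2 i'.2), hIJ]))
  · rw [Matrix.one_apply_ne h, rowMinor_cons_of_mem hq hX, zero_mul]
    simpa [hI] using ⟨fun h' => h (Subtype.ext h'), i.2⟩

theorem leftInv_mul_submatrix [Fintype {i // P i}] (h : IsParam p q lam) (hX : IsQuantumMatrix p q X)
    (hU : HasUnitMinors q X)
    (hI : ∀ i, i ∈ I ↔ P i) (hJ : ∀ j, j ∈ J ↔ Q j) (hIJ : I.card = J.card) :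
    restrict Q P (leftInv p X I J) *
      restrict P Q X = 1 := by
  ext j j'
  have e : (restrict Q P (leftInv p X I J) *
      restrict P Q X) j j' =
        Ring.inverse (rowMinor p X.transpose ((J.erase (j : Fin n)).sort ++ [(j : Fin n)]) I) *
          rowMinor p X.transpose ((J.erase (j : Fin n)).sort ++ [(j' : Fin n)]) I := by
    rw [Matrix.mul_apply, rowMinor_append_singleton _ (j' : Fin n), Finset.mul_sum, Finset.sum_subtype I hI]
    refine Finset.sum_congr rfl fun i _ => ?_
    simp only [leftInv, Matrix.submatrix_apply, Matrix.transpose_apply, mul_smul_comm,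
      smul_mul_assoc, mul_assoc]
  rw [e]
  by_cases hj : j = j'
  · rw [hj, Matrix.one_apply_eq]
    refine Ring.inverse_mul_cancel _ ((hU.transpose h hX).isUnit_rowMinor h.left hX.col
      ((List.perm_append_singleton _ _).nodup_iff.2 (nodup_cons_sort_erase _ _)) ?_)
    rw [List.toFinset_eq_of_perm _ _ (List.perm_append_singleton _ _),
      toFinset_cons_sort_erase ((hJ _).2 j'.2), hIJ]
  · have hj' : (j' : Fin n) ∈ (J.erase j).sort := by
      simpa [hJ] using ⟨fun h' => hj (Subtype.ext h'.symm), j'.2⟩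
    rw [Matrix.one_apply_ne hj, rowMinor_append_of_mem h.left hX.col hj', mul_zero]

variable [Fintype {i // P i}] [Fintype {j // Q j}]

theorem leftInv_eq_rightInv (h : IsParam p q lam) (hX : IsQuantumMatrix p q X)
    (hU : HasUnitMinors q X)
    (hI : ∀ i, i ∈ I ↔ P i) (hJ : ∀ j, j ∈ J ↔ Q j) (hIJ : I.card = J.card) :
    restrict Q P (leftInv p X I J) = restrict Q P (rightInv q X I J) := by
  rw [← Matrix.mul_one (restrict Q P (leftInv p X I J)), ← submatrix_mul_rightInv h.right hX.row hU hI hJ hIJ,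
    ← Matrix.mul_assoc, leftInv_mul_submatrix h hX hU hI hJ hIJ, Matrix.one_mul]

theorem isMatInverse_rightInv (h : IsParam p q lam) (hX : IsQuantumMatrix p q X)
    (hU : HasUnitMinors q X)
    (hI : ∀ i, i ∈ I ↔ P i) (hJ : ∀ j, j ∈ J ↔ Q j) (hIJ : I.card = J.card) :
    IsMatInverse (restrict P Q X) (restrict Q P (rightInv q X I J)) := by
  refine ⟨submatrix_mul_rightInv h.right hX.row hU hI hJ hIJ, ?_⟩
  rw [← leftInv_eq_rightInv h hX hU hI hJ hIJ]
  exact leftInv_mul_submatrix h hX hU hI hJ hIJ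

/-- A quasi-minor is, up to a scalar, the quotient of a quantum minor by the one that lacks its
first row and one column. The rows `i :: r` may be in any order. -/
theorem quasidet_submatrix (h : IsParam p q lam) (hX : IsQuantumMatrix p q X)
    (hU : HasUnitMinors q X) {i : Fin n} {r : List (Fin n)} (hr : (i :: r).Nodup)
    (hI : ∀ k, k ∈ i :: r ↔ P k) (hJ : ∀ j, j ∈ J ↔ Q j)
    (hrJ : (i :: r).toFinset.card = J.card) (hi : P i) (j : {j // Q j}) :
    quasidet (restrict P Q X) ⟨i, hi⟩ j =
      rowMinor q X (i :: r) J * Ring.inverse (leftSign q j J • rowMinor q X r (J.erase j)) := by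
  have hI' : ∀ k, k ∈ (i :: r).toFinset ↔ P k := fun k => by rw [List.mem_toFinset, hI]
  rw [quasidet_eq_of_isMatInverse (isMatInverse_rightInv h hX hU hI' hJ hrJ)]
  have hri : (i :: r).toFinset.erase i = r.toFinset := by
    rw [List.toFinset_cons, Finset.erase_insert]
    simpa using (List.nodup_cons.1 hr).1
  obtain ⟨c, hc0, hc⟩ := exists_rowMinor_perm h.right
    (perm_sort_toFinset (List.nodup_cons.1 hr).2)
  have e : rowMinor q X (i :: r) J = c • rowMinor q X (i :: r.toFinset.sort) J := by
    simp only [rowMinor_cons, hc K X hX.row, Finset.smul_sum, mul_smul_comm, smul_comm c]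
  simp only [rightInv, Matrix.submatrix_apply, hri]
  rw [e, hc K X hX.row]
  have hs := leftSign_ne_zero h.right j J
  have hu1 : IsUnit (rowMinor q X r.toFinset.sort (J.erase j)) := by
    refine hU _ _ ?_
    rw [← hri, Finset.card_erase_of_mem (by simp), Finset.card_erase_of_mem ((hJ _).2 j.2), hrJ]
  have hu2 : IsUnit (rowMinor q X (i :: r.toFinset.sort) J) := by
    refine hU.isUnit_rowMinor h.right hX.row ?_ ?_
    · rw [← hri]
      exact nodup_cons_sort_erase _ _
    · rw [← hri, toFinset_cons_sort_erase (by simp), hrJ]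
  obtain ⟨u, hu⟩ := hu1
  obtain ⟨v, hv⟩ := hu2
  rw [← hu, ← hv, Ring.inverse_unit]
  rw [← Units.val_mul, ringInverse_smul hs, smul_smul, ringInverse_smul (mul_ne_zero hs hc0),
    smul_mul_smul_comm, mul_inv_rev, Units.val_mul, inv_inv, mul_inv_rev,
    mul_inv_cancel_left₀ hc0]

end Submatrix

end Inverse

/-! ### Principal quantum minors commute -/

section Commutation

variable {n : ℕ} {K : Type} [Ring K] [Algebra ℂ K] {p q : Matrix (Fin n) (Fin n) ℂ} {lam : ℂ}
  {X : Matrix (Fin n) (Fin n) K}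

/-- The scalar that sorts the rows is found from the matrix `1`. -/
theorem rowMinor_cons_sort_erase (hq : IsMulAntisymm q) (hX : RowRel q X) {i : Fin n}
    {I : Finset (Fin n)} (hi : i ∈ I) (J : Finset (Fin n)) :
    rowMinor q X (i :: (I.erase i).sort) J = leftSign q i I • rowMinor q X I.sort J := by
  have hp := perm_sort_toFinset (nodup_cons_sort_erase i I)
  rw [toFinset_cons_sort_erase hi] at hp
  obtain ⟨c, -, hc⟩ := exists_rowMinor_perm hq hp
  have h1 := hc ℂ 1 (RowRel.one hq) I
  rw [rowMinor_one_cons _ _ hi, rowMinor_one_sort, rowMinor_one_sort, smul_eq_mul, smul_eq_mul,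
    mul_one, mul_one] at h1
  rw [hc K X hX, h1]

theorem rowMinor_sort_erase_append (hq : IsMulAntisymm q) (hX : RowRel q X) {i : Fin n}
    {I : Finset (Fin n)} (hi : i ∈ I) (J : Finset (Fin n)) :
    rowMinor q X ((I.erase i).sort ++ [i]) J = rightSign q i I • rowMinor q X I.sort J := by
  have hp := (List.perm_append_singleton i (I.erase i).sort).trans
    (perm_sort_toFinset (nodup_cons_sort_erase i I))
  rw [toFinset_cons_sort_erase hi] at hp
  obtain ⟨c, -, hc⟩ := exists_rowMinor_perm hq hp
  have h1 := hc ℂ 1 (RowRel.one hq) I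
  rw [rowMinor_append_singleton, Finset.sum_eq_single_of_mem i hi, Matrix.one_apply_eq, mul_one,
    rowMinor_one_sort, rowMinor_one_sort, smul_eq_mul, smul_eq_mul, mul_one, mul_one] at h1
  · rw [hc K X hX, h1]
  · intro j _ hj
    rw [Matrix.one_apply_ne hj.symm, mul_zero, smul_zero]

/-- The weight of the index `i ∈ I` in the commutation rule of the principal minor of `I`. -/
def commWeight (p q : Matrix (Fin n) (Fin n) ℂ) (I : Finset (Fin n)) (i : Fin n) : ℂ :=
  leftSign q i I * rightSign p i I

theorem commWeight_ne_zero (h : IsParam p q lam) (I : Finset (Fin n)) (i : Fin n) :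
    commWeight p q I i ≠ 0 :=
  mul_ne_zero (leftSign_ne_zero h.right i I) (rightSign_ne_zero h.left i I)

/-- The equality of the two formulas for the inverse of a principal submatrix, as a commutation
rule between the inverse and the principal minor. -/
theorem rightInv_mul_rowMinor (h : IsParam p q lam) (hX : IsQuantumMatrix p q X)
    (hU : HasUnitMinors q X) {I : Finset (Fin n)} {i j : Fin n} (hi : i ∈ I) (hj : j ∈ I) :
    commWeight p q I i • (rightInv q X I I j i * rowMinor q X I.sort I) =
      commWeight p q I j • (rowMinor q X I.sort I * rightInv q X I I j i) := by
  obtain ⟨D, hD⟩ := hU I I rfl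
  have e1 : rightInv q X I I j i = (leftSign q j I * (leftSign q i I)⁻¹) •
      (rowMinor q X (I.erase i).sort (I.erase j) * (D⁻¹ : Kˣ)) := by
    rw [rightInv, rowMinor_cons_sort_erase h.right hX.row hi, ← hD,
      ringInverse_smul (leftSign_ne_zero h.right i I), mul_smul_comm, smul_smul]
  have e2 : rightInv q X I I j i = (rightSign p i I * (rightSign p j I)⁻¹) •
      ((D⁻¹ : Kˣ) * rowMinor q X (I.erase i).sort (I.erase j)) := by
    have e3 := congrFun (congrFun (leftInv_eq_rightInv (P := (· ∈ I)) (Q := (· ∈ I)) h hX hU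
      (fun _ => Iff.rfl) (fun _ => Iff.rfl) rfl) ⟨j, hj⟩) ⟨i, hi⟩
    rw [restrict_apply, restrict_apply] at e3
    rw [← e3, leftInv, rowMinor_sort_erase_append h.left hX.col hj,
      ← hX.rowMinor_sort_transpose h, ← hX.rowMinor_sort_transpose h, ← hD,
      ringInverse_smul (rightSign_ne_zero h.left j I), smul_mul_assoc, smul_smul]
  have hli := leftSign_ne_zero h.right i I
  have hrj := rightSign_ne_zero h.left j I
  conv_lhs => rw [e1]
  conv_rhs => rw [e2]
  rw [← hD, smul_mul_assoc, Units.inv_mul_cancel_right, mul_smul_comm,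
    Units.mul_inv_cancel_left, smul_smul, smul_smul]
  congr 1
  unfold commWeight
  field_simp

/-- A principal minor `D` commutes with the entries of its submatrix up to scalars:
`w_i D x_{ij} = w_j x_{ij} D`. -/
theorem rowMinor_mul_apply (h : IsParam p q lam) (hX : IsQuantumMatrix p q X)
    (hU : HasUnitMinors q X) {I : Finset (Fin n)} {i j : Fin n} (hi : i ∈ I) (hj : j ∈ I) :
    commWeight p q I i • (rowMinor q X I.sort I * X i j) =
      commWeight p q I j • (X i j * rowMinor q X I.sort I) := by
  have hinv := isMatInverse_rightInv (P := (· ∈ I)) (Q := (· ∈ I)) h hX hU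
    (fun _ => Iff.rfl) (fun _ => Iff.rfl) rfl
  set A := restrict (· ∈ I) (· ∈ I) X with hA
  set Y := restrict (· ∈ I) (· ∈ I) (rightInv q X I I) with hY
  -- `Δ` is the principal minor as a scalar matrix, `W` the diagonal matrix of the weights
  set Δ : Matrix {i // i ∈ I} {i // i ∈ I} K := Matrix.diagonal fun _ => rowMinor q X I.sort I
    with hΔ
  set W : Matrix {i // i ∈ I} {i // i ∈ I} K :=
    Matrix.diagonal fun i => algebraMap ℂ K (commWeight p q I i) with hW
  have hc : Y * Δ * W = Δ * W * Y := by
    ext j i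
    rw [hΔ, hW, Matrix.mul_diagonal, Matrix.mul_diagonal, Matrix.diagonal_mul_diagonal,
      Matrix.diagonal_mul, hY, restrict_apply, ← Algebra.commutes, ← Algebra.smul_def,
      rightInv_mul_rowMinor h hX hU i.2 j.2, ← Algebra.commutes, mul_assoc, ← Algebra.smul_def]
  have hc' : Δ * W * A = A * (Δ * W) := by
    calc Δ * W * A = A * (Y * Δ * W) * A := by
          rw [← Matrix.mul_assoc A, ← Matrix.mul_assoc A, hinv.1, Matrix.one_mul]
      _ = A * (Δ * W) := by
          rw [hc, Matrix.mul_assoc A, Matrix.mul_assoc (Δ * W), hinv.2, Matrix.mul_one]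
  have e := congrFun (congrFun hc' ⟨i, hi⟩) ⟨j, hj⟩
  rw [hΔ, hW, Matrix.diagonal_mul_diagonal, Matrix.diagonal_mul, Matrix.mul_diagonal, hA,
    restrict_apply, ← Algebra.commutes, ← Algebra.commutes, mul_assoc,
    ← Algebra.smul_def, ← mul_assoc, ← Algebra.commutes, mul_assoc, ← Algebra.smul_def] at e
  exact e

theorem rowMinor_mul_rowMinor (h : IsParam p q lam) (hX : IsQuantumMatrix p q X)
    (hU : HasUnitMinors q X) {I : Finset (Fin n)} {l : List (Fin n)} (hl : ∀ i ∈ l, i ∈ I)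
    {J : Finset (Fin n)} (hJ : J ⊆ I) :
    (l.map (commWeight p q I)).prod • (rowMinor q X I.sort I * rowMinor q X l J) =
      (∏ j ∈ J, commWeight p q I j) • (rowMinor q X l J * rowMinor q X I.sort I) := by
  induction l generalizing J with
  | nil =>
    rw [rowMinor_nil]
    split_ifs with h0
    · rw [h0, Finset.prod_empty, List.map_nil, List.prod_nil, one_mul, mul_one]
    · rw [mul_zero, zero_mul, smul_zero, smul_zero]
  | cons i l ih =>
    rw [rowMinor_cons, Finset.mul_sum, Finset.sum_mul, Finset.smul_sum, Finset.smul_sum]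
    refine Finset.sum_congr rfl fun j hj => ?_
    have h1 := rowMinor_mul_apply h hX hU (hl i List.mem_cons_self) (hJ hj)
    have h2 := ih (fun k hk => hl k (List.mem_cons_of_mem i hk))
      ((Finset.erase_subset j J).trans hJ)
    rw [List.map_cons, List.prod_cons, ← Finset.mul_prod_erase J _ hj]
    set D := rowMinor q X I.sort I
    set M := rowMinor q X l (J.erase j)
    set w := (l.map (commWeight p q I)).prod
    set v := ∏ j ∈ J.erase j, commWeight p q I j
    calc (commWeight p q I i * w) • (D * leftSign q j J • (X i j * M))
        = (leftSign q j J * w) • ((commWeight p q I i • (D * X i j)) * M) := by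
          simp only [mul_smul_comm, smul_mul_assoc, smul_smul, mul_assoc]
          congr 1
          ring
      _ = (leftSign q j J * commWeight p q I j) • (X i j * (w • (D * M))) := by
          rw [h1]
          simp only [mul_smul_comm, smul_mul_assoc, smul_smul, mul_assoc]
          congr 1
          ring
      _ = (commWeight p q I j * v) • (leftSign q j J • (X i j * M) * D) := by
          rw [h2]
          simp only [mul_smul_comm, smul_mul_assoc, smul_smul, mul_assoc]
          congr 1
          ring

theorem commute_rowMinor_of_subset (h : IsParam p q lam) (hX : IsQuantumMatrix p q X)
    (hU : HasUnitMinors q X) {I J : Finset (Fin n)} (hJ : J ⊆ I) :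
    Commute (rowMinor q X I.sort I) (rowMinor q X J.sort J) := by
  have e := rowMinor_mul_rowMinor h hX hU (I := I) (l := J.sort) (J := J)
    (fun i hi => hJ ((Finset.mem_sort _).1 hi)) hJ
  have hprod : (J.sort.map (commWeight p q I)).prod = ∏ j ∈ J, commWeight p q I j := by
    rw [((Finset.sort_perm_toList J (· ≤ ·)).map _).prod_eq, Finset.prod_map_toList]
  rw [hprod] at e
  exact smul_right_injective K
    (Finset.prod_ne_zero_iff.2 fun j _ => commWeight_ne_zero h I j) e

end Commutation

/-! ### The factorization of the quantum determinant -/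

section Factorization

variable {n : ℕ} {K : Type} [Ring K] [Algebra ℂ K] {p q : Matrix (Fin n) (Fin n) ℂ} {lam : ℂ}
  {X : Matrix (Fin n) (Fin n) K}

/-- The list `σ_k, σ_{k+1}, …` of the indices that remain when `σ_l` is deleted for all `l < k`. -/
def remainingList (σ : Equiv.Perm (Fin n)) (k : ℕ) : List (Fin n) := (List.ofFn σ).drop k

theorem nodup_remainingList (σ : Equiv.Perm (Fin n)) (k : ℕ) : (remainingList σ k).Nodup :=
  (List.nodup_ofFn.2 σ.injective).sublist (List.drop_sublist _ _)

theorem remainingList_eq_cons (σ : Equiv.Perm (Fin n)) (k : Fin n) :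
    remainingList σ k = σ k :: remainingList σ (k + 1) := by
  rw [remainingList, List.drop_eq_getElem_cons (by simp), List.getElem_ofFn]
  rfl

theorem remainingList_zero (σ : Equiv.Perm (Fin n)) : remainingList σ 0 = List.ofFn σ := rfl

theorem remainingList_self (σ : Equiv.Perm (Fin n)) : remainingList σ n = [] :=
  List.drop_eq_nil_of_le (by simp)

theorem mem_remainingList (σ : Equiv.Perm (Fin n)) (k : Fin n) (i : Fin n) :
    i ∈ remainingList σ k ↔ ∀ l < k, i ≠ σ l := by
  rw [remainingList, List.mem_drop_iff_getElem]
  constructor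
  · rintro ⟨m, hm, rfl⟩ l hl h
    rw [List.getElem_ofFn] at h
    have := congrArg Fin.val (σ.injective h)
    simp only at this
    omega
  · intro h
    have hk : ¬σ.symm i < k := fun hlt => h _ hlt (σ.apply_symm_apply i).symm
    rw [not_lt, Fin.le_def] at hk
    refine ⟨(σ.symm i : ℕ) - k, ?_, ?_⟩
    · have := (σ.symm i).2
      simp
      omega
    · rw [List.getElem_ofFn]
      have e : (⟨k + ((σ.symm i : ℕ) - k), by have := (σ.symm i).2; omega⟩ : Fin n) =
          σ.symm i := Fin.ext (by simp; omega)
      rw [e, σ.apply_symm_apply]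

theorem card_remainingList (σ : Equiv.Perm (Fin n)) (k : ℕ) :
    (remainingList σ k).toFinset.card = n - k := by
  rw [List.toFinset_card_of_nodup (nodup_remainingList σ k), remainingList, List.length_drop,
    List.length_ofFn]

/-- The quantum minor of the rows `σ_k, σ_{k+1}, …` and the columns `τ_k, τ_{k+1}, …`, divided by
the same minor of the identity matrix with the rows `τ_k, τ_{k+1}, …`. -/
def normMinor (q : Matrix (Fin n) (Fin n) ℂ) (X : Matrix (Fin n) (Fin n) K)
    (σ τ : Equiv.Perm (Fin n)) (k : ℕ) : K :=
  (rowMinor q (1 : Matrix (Fin n) (Fin n) ℂ) (remainingList τ k) (remainingList τ k).toFinset)⁻¹ •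
    rowMinor q X (remainingList σ k) (remainingList τ k).toFinset

theorem isUnit_normMinor (hq : IsMulAntisymm q) (hX : RowRel q X) (hU : HasUnitMinors q X)
    (σ τ : Equiv.Perm (Fin n)) (k : ℕ) : IsUnit (normMinor q X σ τ k) :=
  isUnit_smul_of_ne_zero (inv_ne_zero (rowMinor_one_ne_zero hq (nodup_remainingList τ k)))
    (hU.isUnit_rowMinor hq hX (nodup_remainingList σ k)
      (by rw [card_remainingList, card_remainingList]))

theorem normMinor_zero (hq : IsMulAntisymm q) (hX : RowRel q X) (σ τ : Equiv.Perm (Fin n)) :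
    normMinor q X σ τ 0 = (qInversion q σ / qInversion q τ) • qDet q X := by
  have e : (List.ofFn τ).toFinset = Finset.univ := by
    ext i
    simpa using τ.surjective i
  rw [normMinor, remainingList_zero, remainingList_zero, e, rowMinor_one_perm,
    rowMinor_perm hq hX, smul_smul, div_eq_inv_mul]

theorem normMinor_self (σ τ : Equiv.Perm (Fin n)) : normMinor q X σ τ n = 1 := by
  rw [normMinor, remainingList_self, remainingList_self, List.toFinset_nil, rowMinor_nil,
    rowMinor_nil, if_pos rfl, if_pos rfl, inv_one, one_smul]

theorem erase_remainingList (τ : Equiv.Perm (Fin n)) (k : Fin n) :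
    (remainingList τ k).toFinset.erase (τ k) = (remainingList τ (k + 1)).toFinset := by
  have h := nodup_remainingList τ k
  rw [remainingList_eq_cons] at h ⊢
  rw [List.toFinset_cons, Finset.erase_insert]
  simpa using (List.nodup_cons.1 h).1

/-- The quasi-minors are the quotients of consecutive normalized quantum minors. -/
theorem quasiMinor_eq (h : IsParam p q lam) (hX : IsQuantumMatrix p q X)
    (hU : HasUnitMinors q X) (σ τ : Equiv.Perm (Fin n)) (k : Fin n) :
    quasiMinor X σ τ k = normMinor q X σ τ k * Ring.inverse (normMinor q X σ τ (k + 1)) := by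
  have hnd := nodup_remainingList σ k
  rw [remainingList_eq_cons] at hnd
  have hτ : τ k ∈ (remainingList τ k).toFinset := by
    rw [remainingList_eq_cons]
    simp
  have e := quasidet_submatrix (P := fun i => ∀ l < k, i ≠ σ l) (Q := fun j => ∀ l < k, j ≠ τ l)
    h hX hU (J := (remainingList τ k).toFinset) hnd
    (fun i => by rw [← remainingList_eq_cons, mem_remainingList])
    (fun j => by rw [List.mem_toFinset, mem_remainingList])
    (by rw [← remainingList_eq_cons, card_remainingList, card_remainingList])
    (Remaining.head σ k).2 (Remaining.head τ k)
  refine e.trans ?_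
  have hg := rowMinor_one_ne_zero h.right (nodup_remainingList τ (k + 1))
  have hs := leftSign_ne_zero h.right (τ k) (remainingList τ k).toFinset
  obtain ⟨u, hu⟩ := hU.isUnit_rowMinor h.right hX.row (nodup_remainingList σ (k + 1))
    (J := (remainingList τ (k + 1)).toFinset) (by rw [card_remainingList, card_remainingList])
  have eg : rowMinor q (1 : Matrix (Fin n) (Fin n) ℂ) (τ k :: remainingList τ (k + 1))
      (remainingList τ k).toFinset = leftSign q (τ k) (remainingList τ k).toFinset *
        rowMinor q (1 : Matrix (Fin n) (Fin n) ℂ) (remainingList τ (k + 1))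
          (remainingList τ (k + 1)).toFinset := by
    rw [rowMinor_one_cons _ _ hτ, erase_remainingList, smul_eq_mul]
  rw [← remainingList_eq_cons] at eg
  have hhead : ((Remaining.head τ k : Remaining τ k) : Fin n) = τ k := rfl
  rw [hhead, erase_remainingList, ← hu, normMinor, normMinor, ← hu, ringInverse_smul hs,
    ringInverse_smul (inv_ne_zero hg), smul_mul_smul_comm, mul_smul_comm, eg,
    ← remainingList_eq_cons]
  congr 1
  field_simp

theorem quasiMinorExists (h : IsParam p q lam) (hX : IsQuantumMatrix p q X)
    (hU : HasUnitMinors q X) (σ τ : Equiv.Perm (Fin n)) (k : Fin n) :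
    QuasiMinorExists X σ τ k := by
  have hI : ∀ (ρ : Equiv.Perm (Fin n)) (i : Fin n),
      i ∈ (remainingList ρ k).toFinset ↔ ∀ l < k, i ≠ ρ l := fun ρ i => by
    rw [List.mem_toFinset, mem_remainingList]
  have hc : (remainingList σ k).toFinset.card = (remainingList τ k).toFinset.card := by
    rw [card_remainingList, card_remainingList]
  exact ⟨_, isMatInverse_rightInv h hX hU (hI σ) (hI τ) hc,
    isUnit_rightInv_apply h.right hX.row hU hc ((hI σ _).2 (Remaining.head σ k).2)
      ((hI τ _).2 (Remaining.head τ k).2)⟩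

theorem quasiMinor_last (h : IsParam p q lam) (hX : IsQuantumMatrix p q X)
    (hU : HasUnitMinors q X) (σ τ : Equiv.Perm (Fin n)) (k : Fin n) (hk : (k : ℕ) + 1 = n) :
    quasiMinor X σ τ k = X (σ k) (τ k) := by
  have hl : ∀ ρ : Equiv.Perm (Fin n), remainingList ρ k = [ρ k] := fun ρ => by
    rw [remainingList_eq_cons, hk, remainingList_self]
  have hs : ∀ (R : Type) [Ring R] [Algebra ℂ R] (Z : Matrix (Fin n) (Fin n) R) (i j : Fin n),
      rowMinor q Z [i] {j} = Z i j := fun R _ _ Z i j => by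
    rw [rowMinor_cons, Finset.sum_singleton, leftSign_eq_one (by simp), rowMinor_nil,
      if_pos (Finset.erase_singleton j), mul_one, one_smul]
  rw [quasiMinor_eq h hX hU, hk, normMinor_self, Ring.inverse_one, mul_one, normMinor, hl, hl,
    List.toFinset_cons, List.toFinset_nil, insert_empty_eq, hs, hs, Matrix.one_apply_eq, inv_one,
    one_smul]

theorem prod_ofFn_mul_inv {G : Type*} [Group G] (u : ℕ → G) (m : ℕ) :
    (List.ofFn fun k : Fin m => u k * (u (k + 1))⁻¹).prod = u 0 * (u m)⁻¹ := by
  induction m with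
  | zero => simp
  | succ m ih =>
    rw [List.ofFn_succ', List.concat_eq_append, List.prod_append, List.prod_singleton]
    simp only [Fin.val_castSucc, Fin.val_last, ih]
    group

theorem prod_quasiMinor (h : IsParam p q lam) (hX : IsQuantumMatrix p q X)
    (hU : HasUnitMinors q X) (σ τ : Equiv.Perm (Fin n)) :
    (List.ofFn fun k => quasiMinor X σ τ k).prod =
      (qInversion q σ / qInversion q τ) • qDet q X := by
  choose u hu using isUnit_normMinor h.right hX.row hU σ τ
  have e : (List.ofFn fun k => quasiMinor X σ τ k) =
      (List.ofFn fun k : Fin n => (u k * (u (k + 1))⁻¹ : Kˣ)).map (Units.coeHom K) := by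
    rw [List.map_ofFn]
    congr 1
    funext k
    rw [quasiMinor_eq h hX hU, ← hu, ← hu, Ring.inverse_unit]
    rfl
  rw [e, ← map_list_prod, prod_ofFn_mul_inv, ← normMinor_zero h.right hX.row, ← hu]
  have hn : u n = 1 := Units.ext (by rw [hu, normMinor_self, Units.val_one])
  rw [hn, inv_one, mul_one]
  rfl

theorem commute_normMinor (h : IsParam p q lam) (hX : IsQuantumMatrix p q X)
    (hU : HasUnitMinors q X) (σ : Equiv.Perm (Fin n)) (k l : ℕ) :
    Commute (normMinor q X σ σ k) (normMinor q X σ σ l) := by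
  wlog hkl : k ≤ l generalizing k l
  · exact (this l k (by omega)).symm
  have hsub : (remainingList σ l).toFinset ⊆ (remainingList σ k).toFinset := by
    intro i hi
    rw [List.mem_toFinset] at hi ⊢
    exact (List.drop_subset_drop_left (List.ofFn σ) hkl) hi
  obtain ⟨c, -, hc⟩ := exists_rowMinor_perm h.right
    (perm_sort_toFinset (nodup_remainingList σ k))
  obtain ⟨d, -, hd⟩ := exists_rowMinor_perm h.right
    (perm_sort_toFinset (nodup_remainingList σ l))
  rw [normMinor, normMinor, hc K X hX.row, hd K X hX.row, smul_smul, smul_smul]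
  exact ((commute_rowMinor_of_subset h hX hU hsub).smul_left _).smul_right _

theorem commute_quasiMinor (h : IsParam p q lam) (hX : IsQuantumMatrix p q X)
    (hU : HasUnitMinors q X) (σ : Equiv.Perm (Fin n)) (k l : Fin n) :
    Commute (quasiMinor X σ σ k) (quasiMinor X σ σ l) := by
  have hc := commute_normMinor h hX hU σ
  choose u hu using isUnit_normMinor h.right hX.row hU σ σ
  simp only [← hu] at hc
  simp only [quasiMinor_eq h hX hU, ← hu, Ring.inverse_unit]
  exact ((hc _ _).mul_right (hc _ _).units_inv_right).mul_left
    ((hc _ _).mul_right (hc _ _).units_inv_right).units_inv_left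

end Factorization

end MultiparamGL

end

theorem mainTheorem3 (n : ℕ) (p q : Matrix (Fin n) (Fin n) ℂ) (lam : ℂ)
    (hp : ∀ i j, p i j * p j i = 1) (hp_diag : ∀ i, p i i = 1)
    (hq : ∀ i j, q i j * q j i = 1) (hq_diag : ∀ i, q i i = 1)
    (hpq : ∀ i j, i < j → p i j * q i j = lam) (hlam : lam ≠ -1) :
    -- all quasi-minors below exist, and the last one is a single entry of the matrix
    (∀ σ τ : Equiv.Perm (Fin n), ∀ k : Fin n,
      MultiparamGL.QuasiMinorExists (MultiparamGL.QFrac.gen p q) σ τ k ∧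
      ((k : ℕ) + 1 = n → MultiparamGL.quasiMinor (MultiparamGL.QFrac.gen p q) σ τ k =
        MultiparamGL.QFrac.gen p q (σ k) (τ k))) ∧
    -- the factorization into principal quasi-minors
    MultiparamGL.qDet q (MultiparamGL.QFrac.gen p q) =
      (List.ofFn fun k => MultiparamGL.quasiMinor (MultiparamGL.QFrac.gen p q) 1 1 k).prod ∧
    -- whose factors commute pairwise
    (∀ k l : Fin n, Commute (MultiparamGL.quasiMinor (MultiparamGL.QFrac.gen p q) 1 1 k)
      (MultiparamGL.quasiMinor (MultiparamGL.QFrac.gen p q) 1 1 l)) ∧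
    -- the factorization for two arbitrary permutations
    ∀ σ τ : Equiv.Perm (Fin n),
      MultiparamGL.qDet q (MultiparamGL.QFrac.gen p q) =
        (MultiparamGL.qInversion q τ / MultiparamGL.qInversion q σ) •
          (List.ofFn fun k => MultiparamGL.quasiMinor (MultiparamGL.QFrac.gen p q) σ τ k).prod := by
  have h : MultiparamGL.IsParam p q lam := ⟨⟨hp, hp_diag⟩, ⟨hq, hq_diag⟩, hpq, hlam⟩
  have hX := MultiparamGL.QFrac.gen_isQuantumMatrix h
  have hU : MultiparamGL.HasUnitMinors q (MultiparamGL.QFrac.gen p q) :=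
    fun I J hIJ => MultiparamGL.QFrac.isUnit_rowMinor h hIJ
  refine ⟨fun σ τ k => ⟨MultiparamGL.quasiMinorExists h hX hU σ τ k,
    MultiparamGL.quasiMinor_last h hX hU σ τ k⟩, ?_,
    MultiparamGL.commute_quasiMinor h hX hU 1, fun σ τ => ?_⟩
  · rw [MultiparamGL.prod_quasiMinor h hX hU, div_self (MultiparamGL.qInversion_ne_zero h.right 1),
      one_smul]
  · have hσ := MultiparamGL.qInversion_ne_zero h.right σ
    have hτ := MultiparamGL.qInversion_ne_zero h.right τ
    rw [MultiparamGL.prod_quasiMinor h hX hU, smul_smul, div_mul_div_cancel₀ hσ, div_self hτ,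
      one_smul]
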